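/- **Definitions.** All algebras are over $\mathbb R$. *$L_\infty$-algebras.* A (finite-dimensional) $L_\infty$-algebra $\mathfrak g$ is a finite-dimensional $\mathbb N_+$-graded vector space $\mathfrak g=\bigoplus_{n\ge 1}\mathfrak g_n$ with a degree $+1$ derivation $d_{\mathrm{CE}}$ of square zero on the free graded-commutative algebra $\wedge^\bullet\mathfrak g^*$, where $\mathfrak g_n^*$ has degree $n$ (this is dual to a degree $-1$ codifferential on the graded-cocommutative coalgebra generated by $\mathfrak g$). Put $\mathrm{CE}(\mathfrak g)=(\wedge^\bullet\mathfrak g^*,d_{\mathrm{CE}})$. The Weil algebra $\mathrm W(\mathfrak g)$ is the free graded-commutative algebra $\wedge^\bullet(\mathfrak g^*\oplus\mathfrak g^*[1])$ with the differential $d_{\mathrm W}a=d_{\mathrm{CE}}a+\sigma a$, $d_{\mathrm W}\sigma a=-\sigma(d_{\mathrm{CE}}a)$ for $a\in\mathfrak g^*$, where $\sigma$ is the degree $+1$ derivation that extends the canonical isomorphism $\mathfrak g^*\to\mathfrak g^*[1]$ by $0$ on $\mathfrak g^*[1]$. There is a canonical surjection $\mathrm W(\mathfrak g)\to\mathrm{CE}(\mathfrak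 g)$, $a\mapsto a$, $\sigma a\mapsto 0$. For $x\in\mathfrak g_n$ let $\iota_x$ be the derivation of $\mathrm W(\mathfrak g)$ of degree $-n$ that is evaluation at $x$ on $\mathfrak g^*$ and $0$ on $\mathfrak g^*[1]$. The dg-algebra of invariant polynomials $\mathrm{inv}(\mathfrak g)\subset\mathrm W(\mathfrak g)$ consists of the $P$ with $\iota_xP=0$ and $\iota_x d_{\mathrm W}P=0$ for all homogeneous $x\in\mathfrak g$. *Descent objects.* Let $X$ be a smooth manifold and $\pi:Y\to X$ a smooth surjective submersion. Let $\Omega^\bullet_{\mathrm{vert}}(Y)$ be the quotient of $\Omega^\bullet(Y)$ by the forms that vanish on vertical vectors (those tangent to the fibres of $\pi$). A $\mathfrak g$-connection descent object over $\pi$ is a triple of dg-algebra morphisms $$A_{\mathrm{vert}}:\mathrm{CE}(\mathfrak g)\to\Omega^\bullet_{\mathrm{vert}}(Y),\qquad (A,F_A):\mathrm W(\mathfrak g)\to\Omega^\bullet(Y),\qquad K:\mathrm{inv}(\mathfrak g)\to\Omega^\bullet(X)$$ compatible with the canonical maps $\mathrm{CE}(\mathfrak g)\leftarrow\mathrm W(\mathfrak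 g)\leftarrow\mathrm{inv}(\mathfrak g)$ and $\Omega^\bullet_{\mathrm{vert}}(Y)\leftarrow\Omega^\bullet(Y)\xleftarrow{\pi^*}\Omega^\bullet(X)$. Its characteristic forms are the forms $K(P)$, $P\in\mathrm{inv}(\mathfrak g)$; its characteristic classes are given by the induced map $H^\bullet(\mathrm{inv}(\mathfrak g))\to H^\bullet_{\mathrm{dR}}(X)$. The pullback along a smooth map $f:Z\to Y$ over $X$, with $Z\to X$ a surjective submersion, is the triple $(f^*A_{\mathrm{vert}},f^*(A,F_A),K)$ over $Z\to X$. *Concordance.* Let $I=[0,1]$. A concordance between two $\mathfrak g$-connection descent objects over the same $\pi:Y\to X$ is a triple of dg-algebra morphisms $\eta_{\mathrm{vert}}:\mathrm{CE}(\mathfrak g)\to\Omega^\bullet_{\mathrm{vert}}(Y\times I)$ (vertical with respect to $Y\times I\to Y\to X$), $\eta:\mathrm W(\mathfrak g)\to\Omega^\bullet(Y\times I)$, $\kappa:\mathrm{inv}(\mathfrak g)\to\Omega^\bullet(X\times I)$, compatible with the canonical maps as above (with $\pi\times\mathrm{id}_I$ in place of $\pi$), whose restrictions to the times $0$ and $1$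 are the three morphisms of the first and of the second object. It is *vertical* if for every $a\in\mathfrak g^*$ the form $\eta(\sigma a)$ on $Y\times I$ has no component along $dt$, i.e. vanishes as soon as one of its arguments is tangent to the $I$-direction. Two descent objects over possibly different surjective submersions $Y\to X$ and $Y'\to X$ are *concordant* (respectively *related by a gauge transformation*) if there is a concordance (respectively a vertical concordance) between their pullbacks to some common refinement, i.e. to a surjective submersion $Z\to X$ with smooth maps $Z\to Y$ and $Z\to Y'$ over $X$. **Theorem.** Let $\mathfrak g$ be an $L_\infty$-algebra, let $X$, $Y$, $Y'$ be smooth manifolds, let $Y\to X$ and $Y'\to X$ be surjective submersions, and let $D$ and $D'$ be $\mathfrak g$-connection descent objects over $Y\to X$ and over $Y'\to X$. 1. If $D$ and $D'$ are concordant, then they have the same characteristic classes: the maps $H^k(\mathrm{inv}(\mathfrak g))\to H^k_{\mathrm{dR}}(X)$ that they induce agree for all $k$. 2. If $D$ and $D'$ are related by a gauge transformation (a vertical concordance), then they have the same characteristic forms: $K(P)=K'(P)\in\Omega^\bullet(X)$ for all $P\in\mathrm{inv}(\mathfrak g)$. -/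

import Mathlib

open scoped Manifold ContDiff

/-! ### Free graded-commutative algebras -/

universe t u v w

/-- The relations of the free graded-commutative algebra: linearity of the generators, and
`a * b = (-1)^(|a| |b|) b * a`. -/
inductive FreeGC.Rel {ι : Type u} (deg : ι → ℕ) (V : ι → Type v)
    [∀ i, AddCommGroup (V i)] [∀ i, Module ℝ (V i)] :
    FreeAlgebra ℝ (Σ i, V i) → FreeAlgebra ℝ (Σ i, V i) → Prop
  | add (i : ι) (a b : V i) :
      FreeGC.Rel deg V (FreeAlgebra.ι ℝ ⟨i, a + b⟩)
        (FreeAlgebra.ι ℝ ⟨i, a⟩ + FreeAlgebra.ι ℝ ⟨i, b⟩)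
  | smul (i : ι) (c : ℝ) (a : V i) :
      FreeGC.Rel deg V (FreeAlgebra.ι ℝ ⟨i, c • a⟩) (c • FreeAlgebra.ι ℝ ⟨i, a⟩)
  | comm (i j : ι) (a : V i) (b : V j) :
      FreeGC.Rel deg V (FreeAlgebra.ι ℝ ⟨i, a⟩ * FreeAlgebra.ι ℝ ⟨j, b⟩)
        ((-1 : ℝ) ^ (deg i * deg j) • (FreeAlgebra.ι ℝ ⟨j, b⟩ * FreeAlgebra.ι ℝ ⟨i, a⟩))

/-- The free graded-commutative real algebra `∧ V` on a family of vector spaces `V i`, placed in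
degrees `deg i`. -/
def FreeGC {ι : Type u} (deg : ι → ℕ) (V : ι → Type v)
    [∀ i, AddCommGroup (V i)] [∀ i, Module ℝ (V i)] : Type (max u v) :=
  RingQuot (FreeGC.Rel deg V)

namespace FreeGC

section
variable {ι : Type u} (deg : ι → ℕ) (V : ι → Type v)
    [∀ i, AddCommGroup (V i)] [∀ i, Module ℝ (V i)]

noncomputable instance instRing : Ring (FreeGC deg V) :=
  inferInstanceAs (Ring (RingQuot (FreeGC.Rel deg V)))

noncomputable instance instAlgebra : Algebra ℝ (FreeGC deg V) :=
  inferInstanceAs (Algebra ℝ (RingQuot (FreeGC.Rel deg V)))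

/-- The quotient map from the free associative algebra. -/
noncomputable def mk : FreeAlgebra ℝ (Σ i, V i) →ₐ[ℝ] FreeGC deg V :=
  RingQuot.mkAlgHom ℝ (FreeGC.Rel deg V)

theorem mk_surjective : Function.Surjective (mk deg V) :=
  RingQuot.mkAlgHom_surjective ℝ (FreeGC.Rel deg V)

/-- The inclusion of the generators. -/
noncomputable def gen (i : ι) : V i →ₗ[ℝ] FreeGC deg V where
  toFun a := mk deg V (FreeAlgebra.ι ℝ ⟨i, a⟩)
  map_add' a b := by
    rw [← map_add]; exact RingQuot.mkAlgHom_rel ℝ (Rel.add i a b)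
  map_smul' c a := by
    rw [RingHom.id_apply, ← map_smul]; exact RingQuot.mkAlgHom_rel ℝ (Rel.smul i c a)

theorem gen_comm (i j : ι) (a : V i) (b : V j) :
    gen deg V i a * gen deg V j b
      = (-1 : ℝ) ^ (deg i * deg j) • (gen deg V j b * gen deg V i a) := by
  change mk deg V _ * mk deg V _ = _ • (mk deg V _ * mk deg V _)
  rw [← map_mul, ← map_mul, ← map_smul]; exact RingQuot.mkAlgHom_rel ℝ (Rel.comm i j a b)

variable {deg V}

theorem induction_left {p : FreeGC deg V → Prop} (one : p 1)
    (add : ∀ x y, p x → p y → p (x + y)) (smul : ∀ (c : ℝ) x, p x → p (c • x))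
    (gen_mul : ∀ i (a : V i) x, p x → p (gen deg V i a * x)) (x : FreeGC deg V) : p x := by
  obtain ⟨x, rfl⟩ := mk_surjective deg V x
  suffices h : ∀ y : FreeGC deg V, p y → p (mk deg V x * y) by simpa using h 1 one
  induction x using FreeAlgebra.induction with
  | grade0 r =>
    intro y hy
    rw [AlgHom.commutes, ← Algebra.smul_def]; exact smul r y hy
  | grade1 s => intro y hy; exact gen_mul s.1 s.2 y hy
  | mul a b ha hb => intro y hy; rw [map_mul, mul_assoc]; exact ha _ (hb _ hy)
  | add a b ha hb => intro y hy; rw [map_add, add_mul]; exact add _ _ (ha y hy) (hb y hy)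

section lift
variable {A : Type w} [Ring A] [Algebra ℝ A]

/-- The universal property of the free graded-commutative algebra. -/
noncomputable def lift (f : ∀ i, V i →ₗ[ℝ] A)
    (hf : ∀ i j a b, f i a * f j b = (-1 : ℝ) ^ (deg i * deg j) • (f j b * f i a)) :
    FreeGC deg V →ₐ[ℝ] A :=
  RingQuot.liftAlgHom ℝ ⟨FreeAlgebra.lift ℝ (fun s : Σ i, V i => f s.1 s.2), by
    intro x y h
    cases h with
    | add i a b => simp
    | smul i c a => simp
    | comm i j a b => simpa using hf i j a b⟩

@[simp] theorem lift_gen (f : ∀ i, V i →ₗ[ℝ] A)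
    (hf : ∀ i j a b, f i a * f j b = (-1 : ℝ) ^ (deg i * deg j) • (f j b * f i a))
    (i : ι) (a : V i) : lift f hf (gen deg V i a) = f i a := by
  change RingQuot.liftAlgHom ℝ _ (RingQuot.mkAlgHom ℝ _ _) = _
  rw [RingQuot.liftAlgHom_mkAlgHom_apply]; simp
end lift

variable (deg V) in
/-- The homogeneous part of degree `k`: the span of all products of generators
`a₁ ⋯ aᵣ` with `deg a₁ + ⋯ + deg aᵣ = k`. -/
noncomputable def homog (k : ℕ) : Submodule ℝ (FreeGC deg V) :=
  Submodule.span ℝ {x | ∃ l : List (Σ i, V i), (l.map fun s => deg s.1).sum = k ∧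
    x = (l.map fun s => gen deg V s.1 s.2).prod}

theorem one_mem_homog : (1 : FreeGC deg V) ∈ homog deg V 0 :=
  Submodule.subset_span ⟨[], by simp, by simp⟩

theorem gen_mem_homog (i : ι) (a : V i) : gen deg V i a ∈ homog deg V (deg i) :=
  Submodule.subset_span ⟨[⟨i, a⟩], by simp, by simp⟩

theorem mul_mem_homog {p q : ℕ} {x y : FreeGC deg V} (hx : x ∈ homog deg V p)
    (hy : y ∈ homog deg V q) : x * y ∈ homog deg V (p + q) := by
  have h : x * y ∈ homog deg V p * homog deg V q := Submodule.mul_mem_mul hx hy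
  rw [homog, homog, Submodule.span_mul_span] at h
  refine Submodule.span_mono ?_ h
  rintro _ ⟨_, ⟨l, hl, rfl⟩, _, ⟨l', hl', rfl⟩, rfl⟩
  exact ⟨l ++ l', by simp [hl, hl'], by simp⟩

/-- Induction on homogeneous elements along monomials, one generator at a time. -/
theorem homog_induction {p : ∀ _ : ℕ, FreeGC deg V → Prop} (zero : ∀ k, p k 0) (one : p 0 1)
    (add : ∀ k x y, p k x → p k y → p k (x + y)) (smul : ∀ k (c : ℝ) x, p k x → p k (c • x))
    (gen_mul : ∀ i (a : V i) k x, x ∈ homog deg V k → p k x → p (deg i + k) (gen deg V i a * x))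
    {k : ℕ} {x : FreeGC deg V} (hx : x ∈ homog deg V k) : p k x := by
  refine Submodule.span_induction (p := fun x _ => p k x) ?_ (zero k)
    (fun x y _ _ => add k x y) (fun c x _ => smul k c x) hx
  clear hx
  rintro _ ⟨l, hl, rfl⟩
  induction l generalizing k with
  | nil => simp at hl; subst hl; simpa using one
  | cons s l ih =>
    have hm : (l.map fun s => gen deg V s.1 s.2).prod ∈
      homog deg V ((l.map fun s => deg s.1).sum) := Submodule.subset_span ⟨l, rfl, rfl⟩
    have := gen_mul s.1 s.2 _ _ hm (ih rfl)
    rw [List.map_cons, List.prod_cons]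
    rw [List.map_cons, List.sum_cons] at hl
    rwa [hl] at this

theorem homog_mul_gen {k : ℕ} {x : FreeGC deg V} (hx : x ∈ homog deg V k) (j : ι) (b : V j) :
    x * gen deg V j b = (-1 : ℝ) ^ (k * deg j) • (gen deg V j b * x) := by
  refine homog_induction (p := fun k x => x * gen deg V j b
    = (-1 : ℝ) ^ (k * deg j) • (gen deg V j b * x)) ?_ ?_ ?_ ?_ ?_ hx
  · simp
  · simp
  · intro k x y hx hy; rw [add_mul, hx, hy, mul_add, smul_add]
  · intro k c x hx; rw [smul_mul_assoc, hx, mul_smul_comm, smul_comm]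
  · intro i a k x _ hx
    rw [mul_assoc, hx, mul_smul_comm, ← mul_assoc, gen_comm, smul_mul_assoc, smul_smul, mul_assoc,
      add_mul, pow_add, mul_comm]

/-- The algebra automorphism that multiplies degree `k` by `(-1)^(j k)`. -/
noncomputable def twist (j : ℕ) : FreeGC deg V →ₐ[ℝ] FreeGC deg V :=
  lift (fun i => (-1 : ℝ) ^ (j * deg i) • gen deg V i) (by
    intro i i' a b
    simp only [LinearMap.smul_apply, smul_mul_assoc, mul_smul_comm]
    rw [gen_comm]
    simp only [smul_smul]
    congr 1; ring)

theorem twist_gen (j : ℕ) (i : ι) (a : V i) :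
    twist j (gen deg V i a) = (-1 : ℝ) ^ (j * deg i) • gen deg V i a := by
  simp [twist]

theorem twist_homog (j : ℕ) {k : ℕ} {x : FreeGC deg V} (hx : x ∈ homog deg V k) :
    twist j x = (-1 : ℝ) ^ (j * k) • x := by
  refine homog_induction (p := fun k x => twist j x = (-1 : ℝ) ^ (j * k) • x) ?_ ?_ ?_ ?_ ?_ hx
  · simp
  · simp
  · intro k x y hx hy; rw [map_add, hx, hy, smul_add]
  · intro k c x hx; rw [map_smul, hx, smul_comm]
  · intro i a k x _ hx
    rw [map_mul, hx, twist_gen, smul_mul_assoc, mul_smul_comm, smul_smul, mul_add, pow_add]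

/-- Auxiliary algebra homomorphism `x ↦ !![±x, δ x; 0, x]` that encodes a derivation. -/
noncomputable def derivAux (j : ℕ) (f : ∀ i, V i →ₗ[ℝ] FreeGC deg V)
    (hf : ∀ i i' (a : V i) (b : V i'), f i a * gen deg V i' b
      = (-1 : ℝ) ^ ((deg i + j) * deg i') • (gen deg V i' b * f i a)) :
    FreeGC deg V →ₐ[ℝ] Matrix (Fin 2) (Fin 2) (FreeGC deg V) :=
  lift (fun i =>
    { toFun := fun a => !![(-1 : ℝ) ^ (j * deg i) • gen deg V i a, f i a; 0, gen deg V i a]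
      map_add' := by
        intro a b; ext r s; fin_cases r <;> fin_cases s <;> simp
      map_smul' := by
        intro c a; ext r s; fin_cases r <;> fin_cases s <;> simp [smul_comm _ c] }) (by
    intro i i' a b
    simp only [LinearMap.coe_mk, AddHom.coe_mk]
    have h1 := gen_comm deg V i i' a b
    have h2 := hf i i' a b
    have h3 := hf i' i b a
    ext r s; fin_cases r <;> fin_cases s
    · simp [Matrix.mul_apply, Fin.sum_univ_two, h1, smul_smul]
      congr 1; ring
    · have h4 : gen deg V i a * f i' b
          = (-1 : ℝ) ^ ((deg i' + j) * deg i) • (f i' b * gen deg V i a) := by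
        rw [h3, smul_smul, ← pow_add, Even.neg_one_pow (Even.add_self _), one_smul]
      simp [Matrix.mul_apply, Fin.sum_univ_two, h2, h4, smul_smul, smul_add]
      rw [add_comm]
      have e1 : (-1 : ℝ) ^ (j * deg i) * (-1) ^ ((deg i' + j) * deg i)
          = (-1) ^ (deg i * deg i') := by
        rw [← pow_add, show j * deg i + (deg i' + j) * deg i
          = deg i * deg i' + (j * deg i + j * deg i) by ring, pow_add,
          Even.neg_one_pow (Even.add_self (j * deg i)), mul_one]
      have e2 : (-1 : ℝ) ^ ((deg i + j) * deg i')
          = (-1) ^ (deg i * deg i') * (-1) ^ (j * deg i') := by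
        rw [← pow_add]; congr 1; ring
      rw [e1, e2]
    · simp [Matrix.mul_apply, Fin.sum_univ_two]
    · simp [Matrix.mul_apply, Fin.sum_univ_two, h1])

theorem derivAux_gen (j : ℕ) (f : ∀ i, V i →ₗ[ℝ] FreeGC deg V)
    (hf : ∀ i i' (a : V i) (b : V i'), f i a * gen deg V i' b
      = (-1 : ℝ) ^ ((deg i + j) * deg i') • (gen deg V i' b * f i a)) (i : ι) (a : V i) :
    derivAux j f hf (gen deg V i a)
      = !![(-1 : ℝ) ^ (j * deg i) • gen deg V i a, f i a; 0, gen deg V i a] := by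
  simp [derivAux]

/-- The graded derivation, of parity `j`, with prescribed values on generators:
`δ(x y) = δ(x) y + (-1)^(j |x|) x δ(y)`. -/
noncomputable def deriv (j : ℕ) (f : ∀ i, V i →ₗ[ℝ] FreeGC deg V)
    (hf : ∀ i i' (a : V i) (b : V i'), f i a * gen deg V i' b
      = (-1 : ℝ) ^ ((deg i + j) * deg i') • (gen deg V i' b * f i a)) :
    FreeGC deg V →ₗ[ℝ] FreeGC deg V where
  toFun x := derivAux j f hf x 0 1
  map_add' x y := by simp
  map_smul' c x := by simp

section deriv
variable (j : ℕ) (f : ∀ i, V i →ₗ[ℝ] FreeGC deg V)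
    (hf : ∀ i i' (a : V i) (b : V i'), f i a * gen deg V i' b
      = (-1 : ℝ) ^ ((deg i + j) * deg i') • (gen deg V i' b * f i a))

theorem deriv_gen (i : ι) (a : V i) : deriv j f hf (gen deg V i a) = f i a := by
  simp [deriv, derivAux_gen]

theorem deriv_one : deriv j f hf 1 = 0 := by
  simp [deriv]

theorem derivAux_entries (x : FreeGC deg V) :
    derivAux j f hf x 1 0 = 0 ∧ derivAux j f hf x 1 1 = x ∧
      derivAux j f hf x 0 0 = twist j x := by
  refine induction_left (p := fun x => derivAux j f hf x 1 0 = 0 ∧ derivAux j f hf x 1 1 = x ∧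
      derivAux j f hf x 0 0 = twist j x) ?_ ?_ ?_ ?_ x
  · simp
  · rintro x y ⟨h1, h2, h3⟩ ⟨h1', h2', h3'⟩
    simp [h1, h2, h3, h1', h2', h3']
  · rintro c x ⟨h1, h2, h3⟩
    simp [h1, h2, h3]
  · rintro i a x ⟨h1, h2, h3⟩
    simp [Matrix.mul_apply, Fin.sum_univ_two, derivAux_gen, h1, h2, h3, twist_gen]

theorem deriv_mul (x y : FreeGC deg V) :
    deriv j f hf (x * y) = deriv j f hf x * y + twist j x * deriv j f hf y := by
  obtain ⟨-, -, h3⟩ := derivAux_entries j f hf x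
  obtain ⟨-, h2, -⟩ := derivAux_entries j f hf y
  change derivAux j f hf (x * y) 0 1 = _
  rw [map_mul, Matrix.mul_apply, Fin.sum_univ_two, h2, h3, add_comm]
  rfl

theorem deriv_mul_of_mem {k : ℕ} {x : FreeGC deg V} (hx : x ∈ homog deg V k) (y : FreeGC deg V) :
    deriv j f hf (x * y) = deriv j f hf x * y + (-1 : ℝ) ^ (j * k) • (x * deriv j f hf y) := by
  rw [deriv_mul, twist_homog j hx, smul_mul_assoc]

theorem deriv_gen_mul (i : ι) (a : V i) (y : FreeGC deg V) :
    deriv j f hf (gen deg V i a * y)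
      = f i a * y + (-1 : ℝ) ^ (j * deg i) • (gen deg V i a * deriv j f hf y) := by
  rw [deriv_mul_of_mem j f hf (gen_mem_homog i a), deriv_gen]
end deriv

/-- A derivation that sends generators of degree `k` to degree `k + 1` raises degrees by one. -/
theorem deriv_mem_homog (f : ∀ i, V i →ₗ[ℝ] FreeGC deg V)
    (hf : ∀ i i' (a : V i) (b : V i'), f i a * gen deg V i' b
      = (-1 : ℝ) ^ ((deg i + 1) * deg i') • (gen deg V i' b * f i a))
    (hd : ∀ i a, f i a ∈ homog deg V (deg i + 1)) {k : ℕ} {x : FreeGC deg V}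
    (hx : x ∈ homog deg V k) : deriv 1 f hf x ∈ homog deg V (k + 1) := by
  refine homog_induction (p := fun k x => deriv 1 f hf x ∈ homog deg V (k + 1))
    ?_ ?_ ?_ ?_ ?_ hx
  · intro k; rw [map_zero]; exact Submodule.zero_mem _
  · rw [deriv_one]; exact Submodule.zero_mem _
  · intro k x y hx hy; rw [map_add]; exact Submodule.add_mem _ hx hy
  · intro k c x hx; rw [map_smul]; exact Submodule.smul_mem _ _ hx
  · intro i a k x hx hx'
    rw [deriv_gen_mul]
    refine Submodule.add_mem _ ?_ (Submodule.smul_mem _ _ ?_)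
    · have := mul_mem_homog (hd i a) hx
      rwa [show deg i + 1 + k = deg i + k + 1 by ring] at this
    · rw [add_assoc]; exact mul_mem_homog (gen_mem_homog i a) hx'

end
end FreeGC

/-! ### Differential graded algebras and their morphisms -/

/-- A differential graded algebra over `ℝ`, in degrees `0, 1, 2, …`: a complex with a unit and a
product. Only the structure needed to speak of morphisms and cohomology is recorded. -/
structure DGData where
  obj : ℕ → Type u
  [addCommGroup : ∀ k, AddCommGroup (obj k)]
  [module : ∀ k, Module ℝ (obj k)]
  one : obj 0
  mul : ∀ p q, obj p →ₗ[ℝ] obj q →ₗ[ℝ] obj (p + q)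
  d : ∀ k, obj k →ₗ[ℝ] obj (k + 1)
  d_d : ∀ k x, d (k + 1) (d k x) = 0

attribute [instance] DGData.addCommGroup DGData.module

/-- A morphism of differential graded algebras: linear in each degree, unital, multiplicative and
compatible with the differentials. -/
structure DGHom (A : DGData.{u}) (B : DGData.{v}) where
  toLin : ∀ k, A.obj k →ₗ[ℝ] B.obj k
  map_one : toLin 0 A.one = B.one
  map_mul : ∀ p q (x : A.obj p) (y : A.obj q),
    toLin (p + q) (A.mul p q x y) = B.mul p q (toLin p x) (toLin q y)
  map_d : ∀ k (x : A.obj k), toLin (k + 1) (A.d k x) = B.d k (toLin k x)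

/-- Composition of morphisms of differential graded algebras. -/
def DGHom.comp {A : DGData.{u}} {B : DGData.{v}} {C : DGData.{w}}
    (g : DGHom B C) (f : DGHom A B) : DGHom A C where
  toLin k := g.toLin k ∘ₗ f.toLin k
  map_one := by simp [f.map_one, g.map_one]
  map_mul p q x y := by simp [f.map_mul, g.map_mul]
  map_d k x := by simp [f.map_d, g.map_d]

namespace DGData

/-- The closed elements of degree `k`. -/
def cocycles (A : DGData.{u}) (k : ℕ) : Submodule ℝ (A.obj k) := LinearMap.ker (A.d k)

/-- The exact elements of degree `k`. -/
def coboundaries (A : DGData.{u}) : ∀ k : ℕ, Submodule ℝ (A.obj k)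
  | 0 => ⊥
  | k + 1 => LinearMap.range (A.d k)

/-- The cohomology in degree `k`: closed elements modulo exact elements. -/
abbrev Cohomology (A : DGData.{u}) (k : ℕ) : Type u :=
  A.cocycles k ⧸ (A.coboundaries k).comap (A.cocycles k).subtype

/-- A differential graded algebra given by graded pieces of an ungraded algebra. -/
noncomputable def ofSubmodules {R : Type u} [Ring R] [Algebra ℝ R] (S : ℕ → Submodule ℝ R)
    (one_mem : (1 : R) ∈ S 0) (mul_mem : ∀ p q x y, x ∈ S p → y ∈ S q → x * y ∈ S (p + q))
    (d : R →ₗ[ℝ] R) (d_mem : ∀ k x, x ∈ S k → d x ∈ S (k + 1))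
    (d_d : ∀ x, d (d x) = 0) : DGData.{u} where
  obj k := S k
  one := ⟨1, one_mem⟩
  mul p q := LinearMap.mk₂ ℝ (fun x y => ⟨x.1 * y.1, mul_mem p q _ _ x.2 y.2⟩)
    (fun x x' y => Subtype.ext (add_mul x.1 x'.1 y.1))
    (fun c x y => Subtype.ext (smul_mul_assoc c x.1 y.1))
    (fun x y y' => Subtype.ext (mul_add x.1 y.1 y'.1))
    (fun c x y => Subtype.ext (mul_smul_comm c x.1 y.1))
  d k := d.restrict (d_mem k)
  d_d _ x := Subtype.ext (d_d x.1)

end DGData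

namespace DGHom

variable {A : DGData.{u}} {B : DGData.{v}}

theorem mem_cocycles (f : DGHom A B) (k : ℕ) (x : A.obj k) (hx : x ∈ A.cocycles k) :
    f.toLin k x ∈ B.cocycles k := by
  have h : A.d k x = 0 := hx
  change B.d k (f.toLin k x) = 0
  rw [← f.map_d, h, map_zero]

theorem mem_coboundaries (f : DGHom A B) (k : ℕ) (x : A.obj k) (hx : x ∈ A.coboundaries k) :
    f.toLin k x ∈ B.coboundaries k := by
  cases k with
  | zero =>
    have h : x = 0 := hx
    rw [h, map_zero]; exact Submodule.zero_mem _
  | succ k =>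
    obtain ⟨y, rfl⟩ := hx
    exact ⟨f.toLin k y, (f.map_d k y).symm⟩

/-- The map induced on cohomology. -/
noncomputable def mapCohomology (f : DGHom A B) (k : ℕ) : A.Cohomology k →ₗ[ℝ] B.Cohomology k :=
  Submodule.mapQ _ _ ((f.toLin k).restrict (f.mem_cocycles k))
    (fun x hx => f.mem_coboundaries k x.1 hx)

end DGHom

/-! ### `L∞`-algebras -/

/-- A finite-dimensional `L∞`-algebra over `ℝ`: an `ℕ₊`-graded finite-dimensional vector space `g`
together with a differential (a derivation of degree `+1` with square zero) on the free
graded-commutative algebra `∧ g^*`, where the dual of the degree `n` part of `g` has degree `n`.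
An ordinary Lie algebra is concentrated in degree `1`. -/
structure LInfinityAlgebra where
  space : ℕ+ → Type u
  [addCommGroup : ∀ n, AddCommGroup (space n)]
  [module : ∀ n, Module ℝ (space n)]
  finite : FiniteDimensional ℝ (DirectSum ℕ+ space)
  d : FreeGC (fun n : ℕ+ => (n : ℕ)) (fun n => Module.Dual ℝ (space n)) →ₗ[ℝ]
    FreeGC (fun n : ℕ+ => (n : ℕ)) (fun n => Module.Dual ℝ (space n))
  d_mem : ∀ k x, x ∈ FreeGC.homog (fun n : ℕ+ => (n : ℕ)) (fun n => Module.Dual ℝ (space n)) k →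
    d x ∈ FreeGC.homog (fun n : ℕ+ => (n : ℕ)) (fun n => Module.Dual ℝ (space n)) (k + 1)
  leibniz : ∀ k x y,
    x ∈ FreeGC.homog (fun n : ℕ+ => (n : ℕ)) (fun n => Module.Dual ℝ (space n)) k →
    d (x * y) = d x * y + (-1 : ℝ) ^ k • (x * d y)
  d_d : ∀ x, d (d x) = 0

attribute [instance] LInfinityAlgebra.addCommGroup LInfinityAlgebra.module

namespace LInfinityAlgebra

variable (g : LInfinityAlgebra.{u})

/-- The graded-commutative algebra `∧ g^*`. -/
abbrev ceAlg : Type u :=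
  FreeGC (fun n : ℕ+ => (n : ℕ)) (fun n => Module.Dual ℝ (g.space n))

/-- The generators `g^* ⊂ ∧ g^*`. -/
noncomputable abbrev ceGen (n : ℕ+) : Module.Dual ℝ (g.space n) →ₗ[ℝ] g.ceAlg :=
  FreeGC.gen (fun n : ℕ+ => (n : ℕ)) (fun n => Module.Dual ℝ (g.space n)) n

/-- The degree `k` part of `∧ g^*`. -/
noncomputable abbrev ceHomog (k : ℕ) : Submodule ℝ g.ceAlg :=
  FreeGC.homog (fun n : ℕ+ => (n : ℕ)) (fun n => Module.Dual ℝ (g.space n)) k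

/-- The Chevalley–Eilenberg algebra `CE(g) = (∧ g^*, d)`. -/
noncomputable def CE : DGData.{u} :=
  DGData.ofSubmodules g.ceHomog FreeGC.one_mem_homog
    (fun _ _ _ _ hx hy => FreeGC.mul_mem_homog hx hy) g.d g.d_mem g.d_d

/-- Degrees of the generators of the Weil algebra: `(n, false)` labels the copy of the dual of `g_n`
in degree `n`, and `(n, true)` the shifted copy in degree `n + 1`. -/
def weilDeg (i : ℕ+ × Bool) : ℕ := (i.1 : ℕ) + i.2.toNat

/-- The graded-commutative algebra `∧ (g^* ⊕ g^*[1])`. -/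
abbrev weilAlg : Type u :=
  FreeGC weilDeg (fun i : ℕ+ × Bool => Module.Dual ℝ (g.space i.1))

/-- The degree `k` part of `∧ (g^* ⊕ g^*[1])`. -/
noncomputable abbrev weilHomog (k : ℕ) : Submodule ℝ g.weilAlg :=
  FreeGC.homog weilDeg (fun i : ℕ+ × Bool => Module.Dual ℝ (g.space i.1)) k

/-- The generators of the Weil algebra. -/
noncomputable abbrev weilGen (i : ℕ+ × Bool) : Module.Dual ℝ (g.space i.1) →ₗ[ℝ] g.weilAlg :=
  FreeGC.gen weilDeg (fun i : ℕ+ × Bool => Module.Dual ℝ (g.space i.1)) i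

/-- The unshifted generators `g^*` of the Weil algebra. -/
noncomputable def unshifted (n : ℕ+) : Module.Dual ℝ (g.space n) →ₗ[ℝ] g.weilAlg :=
  g.weilGen (n, false)

/-- The shifted generators `g^*[1]` of the Weil algebra. -/
noncomputable def shifted (n : ℕ+) : Module.Dual ℝ (g.space n) →ₗ[ℝ] g.weilAlg :=
  g.weilGen (n, true)

theorem unshifted_mem (n : ℕ+) (a : Module.Dual ℝ (g.space n)) :
    g.unshifted n a ∈ g.weilHomog n :=
  FreeGC.gen_mem_homog (deg := weilDeg) (V := fun i : ℕ+ × Bool => Module.Dual ℝ (g.space i.1))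
    (n, false) a

theorem shifted_mem (n : ℕ+) (a : Module.Dual ℝ (g.space n)) :
    g.shifted n a ∈ g.weilHomog (n + 1) :=
  FreeGC.gen_mem_homog (deg := weilDeg) (V := fun i : ℕ+ × Bool => Module.Dual ℝ (g.space i.1))
    (n, true) a

/-- The inclusion of algebras `∧ g^* ⊂ ∧ (g^* ⊕ g^*[1])`; it does not respect the differentials. -/
noncomputable def ceToWeil : g.ceAlg →ₐ[ℝ] g.weilAlg :=
  FreeGC.lift g.unshifted fun n m a b => FreeGC.gen_comm weilDeg
    (fun i : ℕ+ × Bool => Module.Dual ℝ (g.space i.1)) (n, false) (m, false) a b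

theorem ceGen_mem (n : ℕ+) (a : Module.Dual ℝ (g.space n)) : g.ceGen n a ∈ g.ceHomog n :=
  FreeGC.gen_mem_homog (deg := fun n : ℕ+ => (n : ℕ)) (V := fun n => Module.Dual ℝ (g.space n)) n a

theorem ceToWeil_gen (n : ℕ+) (a : Module.Dual ℝ (g.space n)) :
    g.ceToWeil (g.ceGen n a) = g.unshifted n a :=
  FreeGC.lift_gen (deg := fun n : ℕ+ => (n : ℕ)) (V := fun n => Module.Dual ℝ (g.space n)) _ _ n a

theorem ceToWeil_mem {k : ℕ} {x : g.ceAlg} (hx : x ∈ g.ceHomog k) :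
    g.ceToWeil x ∈ g.weilHomog k := by
  refine FreeGC.homog_induction (p := fun k x => g.ceToWeil x ∈ g.weilHomog k)
    ?_ ?_ ?_ ?_ ?_ hx
  · intro k; rw [map_zero]; exact Submodule.zero_mem _
  · rw [map_one]; exact FreeGC.one_mem_homog
  · intro k x y hx hy; rw [map_add]; exact Submodule.add_mem _ hx hy
  · intro k c x hx; rw [map_smul]; exact Submodule.smul_mem _ _ hx
  · intro n a k x _ hx
    rw [map_mul, ceToWeil_gen]
    exact FreeGC.mul_mem_homog (g.unshifted_mem n a) hx

theorem homog_mul_gen_succ {i : ℕ+ × Bool} {x : g.weilAlg} (hx : x ∈ g.weilHomog (weilDeg i + 1))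
    (i' : ℕ+ × Bool) (b : Module.Dual ℝ (g.space i'.1)) :
    x * FreeGC.gen weilDeg (fun i : ℕ+ × Bool => Module.Dual ℝ (g.space i.1)) i' b
      = (-1 : ℝ) ^ ((weilDeg i + 1) * weilDeg i') •
        (FreeGC.gen weilDeg (fun i : ℕ+ × Bool => Module.Dual ℝ (g.space i.1)) i' b * x) :=
  FreeGC.homog_mul_gen hx i' b

/-- The values of `σ` on generators. -/
noncomputable def sigmaGen :
    ∀ i : ℕ+ × Bool, Module.Dual ℝ (g.space i.1) →ₗ[ℝ] g.weilAlg
  | (n, false) => g.shifted n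
  | (_, true) => 0

theorem sigmaGen_mem : ∀ (i : ℕ+ × Bool) (a : Module.Dual ℝ (g.space i.1)),
    g.sigmaGen i a ∈ g.weilHomog (weilDeg i + 1)
  | (n, false), a => g.shifted_mem n a
  | (_, true), _ => Submodule.zero_mem _

/-- The derivation `σ` of degree `+1` that is the canonical isomorphism `g^* → g^*[1]` on the
unshifted generators and zero on the shifted ones. -/
noncomputable def sigma : g.weilAlg →ₗ[ℝ] g.weilAlg :=
  FreeGC.deriv 1 g.sigmaGen fun i i' a b => g.homog_mul_gen_succ (g.sigmaGen_mem i a) i' b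

theorem sigma_mem {k : ℕ} {x : g.weilAlg} (hx : x ∈ g.weilHomog k) :
    g.sigma x ∈ g.weilHomog (k + 1) :=
  FreeGC.deriv_mem_homog _ _ g.sigmaGen_mem hx

/-- The values of the Weil differential on generators: `d a = d_CE a + σ a` and
`d (σ a) = -σ (d_CE a)`. -/
noncomputable def weilDGen :
    ∀ i : ℕ+ × Bool, Module.Dual ℝ (g.space i.1) →ₗ[ℝ] g.weilAlg
  | (n, false) => g.ceToWeil.toLinearMap ∘ₗ g.d ∘ₗ g.ceGen n + g.shifted n
  | (n, true) => -(g.sigma ∘ₗ g.ceToWeil.toLinearMap ∘ₗ g.d ∘ₗ g.ceGen n)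

theorem weilDGen_mem : ∀ (i : ℕ+ × Bool) (a : Module.Dual ℝ (g.space i.1)),
    g.weilDGen i a ∈ g.weilHomog (weilDeg i + 1)
  | (n, false), a => Submodule.add_mem _
      (g.ceToWeil_mem (g.d_mem n _ (g.ceGen_mem n a))) (g.shifted_mem n a)
  | (n, true), a => Submodule.neg_mem _
      (g.sigma_mem (g.ceToWeil_mem (g.d_mem n _ (g.ceGen_mem n a))))

/-- The differential of the Weil algebra. -/
noncomputable def weilD : g.weilAlg →ₗ[ℝ] g.weilAlg :=
  FreeGC.deriv 1 g.weilDGen fun i i' a b => g.homog_mul_gen_succ (g.weilDGen_mem i a) i' b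

theorem weilD_mem (k : ℕ) (x : g.weilAlg) (hx : x ∈ g.weilHomog k) :
    g.weilD x ∈ g.weilHomog (k + 1) :=
  FreeGC.deriv_mem_homog _ _ g.weilDGen_mem hx

theorem weilD_unshifted (n : ℕ+) (a : Module.Dual ℝ (g.space n)) :
    g.weilD (g.unshifted n a) = g.ceToWeil (g.d (g.ceGen n a)) + g.shifted n a :=
  FreeGC.deriv_gen
    (deg := weilDeg) (V := fun i : ℕ+ × Bool => Module.Dual ℝ (g.space i.1)) _ _ _ (n, false) a

theorem weilD_shifted (n : ℕ+) (a : Module.Dual ℝ (g.space n)) :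
    g.weilD (g.shifted n a) = -g.sigma (g.ceToWeil (g.d (g.ceGen n a))) :=
  FreeGC.deriv_gen
    (deg := weilDeg) (V := fun i : ℕ+ × Bool => Module.Dual ℝ (g.space i.1)) _ _ _ (n, true) a

theorem weilD_mul {k : ℕ} {x : g.weilAlg} (hx : x ∈ g.weilHomog k) (y : g.weilAlg) :
    g.weilD (x * y) = g.weilD x * y + (-1 : ℝ) ^ k • (x * g.weilD y) := by
  have := FreeGC.deriv_mul_of_mem 1 g.weilDGen
    (fun i i' a b => g.homog_mul_gen_succ (g.weilDGen_mem i a) i' b) hx y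
  rwa [one_mul] at this

theorem sigma_mul {k : ℕ} {x : g.weilAlg} (hx : x ∈ g.weilHomog k) (y : g.weilAlg) :
    g.sigma (x * y) = g.sigma x * y + (-1 : ℝ) ^ k • (x * g.sigma y) := by
  have := FreeGC.deriv_mul_of_mem 1 g.sigmaGen
    (fun i i' a b => g.homog_mul_gen_succ (g.sigmaGen_mem i a) i' b) hx y
  rwa [one_mul] at this

theorem sigma_unshifted (n : ℕ+) (a : Module.Dual ℝ (g.space n)) :
    g.sigma (g.unshifted n a) = g.shifted n a :=
  FreeGC.deriv_gen
    (deg := weilDeg) (V := fun i : ℕ+ × Bool => Module.Dual ℝ (g.space i.1)) _ _ _ (n, false) a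

theorem d_one : g.d 1 = 0 := by
  have h := g.leibniz 0 1 1 FreeGC.one_mem_homog
  simpa using h

/-- On `∧ g^* ⊂ W(g)`, the Weil differential is `d_CE + σ`. -/
theorem weilD_ceToWeil (x : g.ceAlg) :
    g.weilD (g.ceToWeil x) = g.ceToWeil (g.d x) + g.sigma (g.ceToWeil x) := by
  refine FreeGC.induction_left (p := fun x =>
    g.weilD (g.ceToWeil x) = g.ceToWeil (g.d x) + g.sigma (g.ceToWeil x)) ?_ ?_ ?_ ?_ x
  · simp [d_one, weilD, sigma, FreeGC.deriv_one]
  · intro x y hx hy; simp only [map_add, hx, hy]; abel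
  · intro c x hx; simp only [map_smul, hx, smul_add]
  · intro n a x hx
    rw [g.leibniz n _ _ (g.ceGen_mem n a)]
    simp only [map_mul, map_add, map_smul]
    rw [g.ceToWeil_gen, g.weilD_mul (g.unshifted_mem n a), g.sigma_mul (g.unshifted_mem n a), hx,
      g.weilD_unshifted, g.sigma_unshifted, add_mul, mul_add, smul_add]
    abel

theorem weilD_weilD_gen_mul {k : ℕ} {a x : g.weilAlg} (ha : a ∈ g.weilHomog k)
    (h : g.weilD (g.weilD a) = 0) (hx : g.weilD (g.weilD x) = 0) :
    g.weilD (g.weilD (a * x)) = 0 := by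
  rw [g.weilD_mul ha, map_add, map_smul, g.weilD_mul ha, g.weilD_mul (g.weilD_mem k a ha), h, hx,
    zero_mul, mul_zero, smul_zero, zero_add, add_zero, pow_succ]
  simp

theorem weilD_weilD_unshifted (n : ℕ+) (a : Module.Dual ℝ (g.space n)) :
    g.weilD (g.weilD (g.unshifted n a)) = 0 := by
  rw [g.weilD_unshifted, map_add, g.weilD_ceToWeil, g.weilD_shifted, g.d_d, map_zero]
  simp

theorem weilD_weilD_ceToWeil (x : g.ceAlg) : g.weilD (g.weilD (g.ceToWeil x)) = 0 := by
  refine FreeGC.induction_left (p := fun x => g.weilD (g.weilD (g.ceToWeil x)) = 0) ?_ ?_ ?_ ?_ x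
  · simp [weilD, FreeGC.deriv_one]
  · intro x y hx hy; simp only [map_add, hx, hy, add_zero]
  · intro c x hx; simp only [map_smul, hx, smul_zero]
  · intro n a x hx
    rw [map_mul, g.ceToWeil_gen]
    exact g.weilD_weilD_gen_mul (g.unshifted_mem n a) (g.weilD_weilD_unshifted n a) hx

theorem weilD_weilD_shifted (n : ℕ+) (a : Module.Dual ℝ (g.space n)) :
    g.weilD (g.weilD (g.shifted n a)) = 0 := by
  have h := g.weilD_ceToWeil (g.d (g.ceGen n a))
  rw [g.d_d, map_zero, zero_add] at h
  rw [g.weilD_shifted, map_neg, ← h, g.weilD_weilD_ceToWeil, neg_zero]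

theorem weilD_weilD (x : g.weilAlg) : g.weilD (g.weilD x) = 0 := by
  refine FreeGC.induction_left (p := fun x => g.weilD (g.weilD x) = 0) ?_ ?_ ?_ ?_ x
  · simp [weilD, FreeGC.deriv_one]
  · intro x y hx hy; simp only [map_add, hx, hy, add_zero]
  · intro c x hx; simp only [map_smul, hx, smul_zero]
  · rintro ⟨n, b⟩ a x hx
    cases b with
    | false => exact g.weilD_weilD_gen_mul (g.unshifted_mem n a) (g.weilD_weilD_unshifted n a) hx
    | true => exact g.weilD_weilD_gen_mul (g.shifted_mem n a) (g.weilD_weilD_shifted n a) hx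

/-- The Weil algebra `W(g)`. -/
noncomputable def W : DGData.{u} :=
  DGData.ofSubmodules g.weilHomog FreeGC.one_mem_homog
    (fun _ _ _ _ hx hy => FreeGC.mul_mem_homog hx hy) g.weilD g.weilD_mem g.weilD_weilD

/-- The values of `W(g) → CE(g)` on generators: `a ↦ a` and `σ a ↦ 0`. -/
noncomputable def weilToCEGen :
    ∀ i : ℕ+ × Bool, Module.Dual ℝ (g.space i.1) →ₗ[ℝ] g.ceAlg
  | (n, false) => g.ceGen n
  | (_, true) => 0

/-- The algebra map underlying `W(g) → CE(g)`. -/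
noncomputable def weilToCE : g.weilAlg →ₐ[ℝ] g.ceAlg :=
  FreeGC.lift g.weilToCEGen (by
    rintro ⟨n, b⟩ ⟨m, c⟩ a a'
    cases b <;> cases c
    · exact FreeGC.gen_comm (fun n : ℕ+ => (n : ℕ)) (fun n => Module.Dual ℝ (g.space n)) n m a a'
    all_goals simp [weilToCEGen])

theorem weilToCE_unshifted (n : ℕ+) (a : Module.Dual ℝ (g.space n)) :
    g.weilToCE (g.unshifted n a) = g.ceGen n a :=
  FreeGC.lift_gen
    (deg := weilDeg) (V := fun i : ℕ+ × Bool => Module.Dual ℝ (g.space i.1)) _ _ (n, false) a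

theorem weilToCE_shifted (n : ℕ+) (a : Module.Dual ℝ (g.space n)) :
    g.weilToCE (g.shifted n a) = 0 :=
  FreeGC.lift_gen
    (deg := weilDeg) (V := fun i : ℕ+ × Bool => Module.Dual ℝ (g.space i.1)) _ _ (n, true) a

theorem weilToCE_ceToWeil (x : g.ceAlg) : g.weilToCE (g.ceToWeil x) = x := by
  refine FreeGC.induction_left (p := fun x => g.weilToCE (g.ceToWeil x) = x) ?_ ?_ ?_ ?_ x
  · simp
  · intro x y hx hy; simp only [map_add, hx, hy]
  · intro c x hx; simp only [map_smul, hx]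
  · intro n a x hx
    rw [map_mul, map_mul, hx]
    congr 1
    exact (congrArg _ (g.ceToWeil_gen n a)).trans (g.weilToCE_unshifted n a)

theorem weilToCE_sigma (x : g.weilAlg) : g.weilToCE (g.sigma x) = 0 := by
  refine FreeGC.induction_left (p := fun x => g.weilToCE (g.sigma x) = 0) ?_ ?_ ?_ ?_ x
  · simp [sigma, FreeGC.deriv_one]
  · intro x y hx hy; simp only [map_add, hx, hy, add_zero]
  · intro c x hx; simp only [map_smul, hx, smul_zero]
  · intro i a x hx
    rw [g.sigma_mul (FreeGC.gen_mem_homog i a), map_add, map_smul, map_mul, map_mul, hx]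
    have h : g.weilToCE (g.sigma (g.weilGen i a)) = 0 := by
      rw [sigma, FreeGC.deriv_gen]
      obtain ⟨n, b⟩ := i
      cases b with
      | false => exact g.weilToCE_shifted n a
      | true => exact map_zero g.weilToCE
    rw [h]; simp

theorem weilToCE_mem {k : ℕ} {x : g.weilAlg} (hx : x ∈ g.weilHomog k) :
    g.weilToCE x ∈ g.ceHomog k := by
  refine FreeGC.homog_induction (p := fun k x => g.weilToCE x ∈ g.ceHomog k)
    ?_ ?_ ?_ ?_ ?_ hx
  · intro k; rw [map_zero]; exact Submodule.zero_mem _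
  · rw [map_one]; exact FreeGC.one_mem_homog
  · intro k x y hx hy; rw [map_add]; exact Submodule.add_mem _ hx hy
  · intro k c x hx; rw [map_smul]; exact Submodule.smul_mem _ _ hx
  · rintro ⟨n, b⟩ a k x _ hx
    rw [map_mul]
    cases b with
    | false =>
      have e : g.weilToCE (g.weilGen (n, false) a) = g.ceGen n a := g.weilToCE_unshifted n a
      rw [e]
      exact FreeGC.mul_mem_homog (g.ceGen_mem n a) hx
    | true =>
      have e : g.weilToCE (g.weilGen (n, true) a) = 0 := g.weilToCE_shifted n a
      rw [e, zero_mul]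
      exact Submodule.zero_mem _

theorem weilToCE_weilD (x : g.weilAlg) : g.weilToCE (g.weilD x) = g.d (g.weilToCE x) := by
  refine FreeGC.induction_left (p := fun x => g.weilToCE (g.weilD x) = g.d (g.weilToCE x))
    ?_ ?_ ?_ ?_ x
  · simp [d_one, weilD, FreeGC.deriv_one]
  · intro x y hx hy; simp only [map_add, hx, hy]
  · intro c x hx; simp only [map_smul, hx]
  · rintro ⟨n, b⟩ a x hx
    rw [g.weilD_mul (FreeGC.gen_mem_homog (n, b) a), map_add, map_smul, map_mul, map_mul, map_mul,
      hx]
    cases b with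
    | false =>
      have e : g.weilToCE (g.weilGen (n, false) a) = g.ceGen n a :=
        g.weilToCE_unshifted n a
      have e' : g.weilToCE (g.weilD (g.weilGen (n, false) a)) = g.d (g.ceGen n a) := by
        refine (congrArg _ (g.weilD_unshifted n a)).trans ?_
        rw [map_add, g.weilToCE_ceToWeil, g.weilToCE_shifted, add_zero]
      rw [e, e', g.leibniz n _ _ (g.ceGen_mem n a)]
      rfl
    | true =>
      have e : g.weilToCE (g.weilGen (n, true) a) = 0 :=
        g.weilToCE_shifted n a
      have e' : g.weilToCE (g.weilD (g.weilGen (n, true) a)) = 0 := by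
        refine (congrArg _ (g.weilD_shifted n a)).trans ?_
        rw [map_neg, g.weilToCE_sigma, neg_zero]
      rw [e, e']; simp

/-- The canonical surjection `i^* : W(g) → CE(g)`. -/
noncomputable def WtoCE : DGHom g.W g.CE where
  toLin _ := g.weilToCE.toLinearMap.restrict fun _ hx => g.weilToCE_mem hx
  map_one := Subtype.ext (map_one g.weilToCE)
  map_mul _ _ x y := Subtype.ext (map_mul g.weilToCE x.1 y.1)
  map_d _ x := Subtype.ext (g.weilToCE_weilD x.1)

/-- The values of the contraction with `X` in `g_n` on generators: `a ↦ a(X)` for `a` in the dual of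
`g_n`, and all other generators, in particular the shifted ones, go to zero. -/
noncomputable def contractionGen (n : ℕ+) (X : g.space n) :
    ∀ i : ℕ+ × Bool, Module.Dual ℝ (g.space i.1) →ₗ[ℝ] g.weilAlg
  | (m, false) => Algebra.linearMap ℝ g.weilAlg ∘ₗ
      Module.Dual.eval ℝ (g.space m) (Pi.single n X m)
  | (_, true) => 0

/-- The contraction `ι_X` with `X` in `g_n`, a graded derivation of `W(g)` of degree `-n`. -/
noncomputable def contraction (n : ℕ+) (X : g.space n) : g.weilAlg →ₗ[ℝ] g.weilAlg :=
  FreeGC.deriv n (g.contractionGen n X) (by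
    rintro ⟨m, b⟩ i' a a'
    cases b with
    | false =>
      by_cases h : m = n
      · subst h
        have hs : (-1 : ℝ) ^ ((weilDeg (m, false) + m) * weilDeg i') = 1 :=
          Even.neg_one_pow (Even.mul_right (by simp [weilDeg]) _)
        rw [hs, one_smul]
        exact Algebra.commutes (R := ℝ) _ _
      · simp [contractionGen, Pi.single_eq_of_ne h]
    | true => simp [contractionGen])

theorem contraction_mul {k : ℕ} {x : g.weilAlg} (hx : x ∈ g.weilHomog k) (y : g.weilAlg) (n : ℕ+)
    (X : g.space n) : g.contraction n X (x * y) = g.contraction n X x * y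
      + (-1 : ℝ) ^ ((n : ℕ) * k) • (x * g.contraction n X y) :=
  FreeGC.deriv_mul_of_mem (n : ℕ) (g.contractionGen n X) _ hx y

/-- The degree `k` part of the algebra of basic elements of `W(g)`: the elements annihilated by all
contractions `ι_X` and by all Lie derivatives `L_X = [d, ι_X]`. On the kernel of `ι_X` the second
condition reads `ι_X (d P) = 0`. -/
noncomputable def invHomog (k : ℕ) : Submodule ℝ g.weilAlg :=
  g.weilHomog k ⊓ ⨅ (n : ℕ+) (X : g.space n),
    LinearMap.ker (g.contraction n X) ⊓ LinearMap.ker (g.contraction n X ∘ₗ g.weilD)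

theorem mem_invHomog {k : ℕ} {x : g.weilAlg} : x ∈ g.invHomog k ↔ x ∈ g.weilHomog k ∧
    ∀ (n : ℕ+) (X : g.space n), g.contraction n X x = 0 ∧ g.contraction n X (g.weilD x) = 0 := by
  simp [invHomog, Submodule.mem_iInf]

/-- The algebra of invariant polynomials `inv(g) = W(g)_basic`, with the differential of `W(g)`. -/
noncomputable def inv : DGData.{u} :=
  DGData.ofSubmodules g.invHomog
    (g.mem_invHomog.2 ⟨FreeGC.one_mem_homog, fun n X => by
      simp [contraction, weilD, FreeGC.deriv_one]⟩)
    (fun p q x y hx hy => by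
      rw [mem_invHomog] at hx hy ⊢
      refine ⟨FreeGC.mul_mem_homog hx.1 hy.1, fun n X => ⟨?_, ?_⟩⟩
      · rw [g.contraction_mul hx.1, (hx.2 n X).1, (hy.2 n X).1]; simp
      · rw [g.weilD_mul hx.1, map_add, map_smul, g.contraction_mul (g.weilD_mem p x hx.1),
          g.contraction_mul hx.1, (hx.2 n X).1, (hx.2 n X).2, (hy.2 n X).1, (hy.2 n X).2]
        simp)
    g.weilD
    (fun _ x hx => by
      rw [mem_invHomog] at hx ⊢
      exact ⟨g.weilD_mem _ x hx.1, fun n X => ⟨(hx.2 n X).2, by simp [g.weilD_weilD]⟩⟩)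
    g.weilD_weilD

/-- The inclusion `inv(g) → W(g)`. -/
noncomputable def invToW : DGHom g.inv g.W where
  toLin _ := Submodule.inclusion inf_le_left
  map_one := rfl
  map_mul _ _ _ _ := rfl
  map_d _ _ := rfl

end LInfinityAlgebra

/-! ### Differential forms -/

/-- The Cartesian space `ℝ^m`. -/
abbrev Cart (m : ℕ) : Type := EuclideanSpace ℝ (Fin m)

/-- Alternating `k`-forms on the vector space `ℝ^m`. -/
abbrev Alt (m k : ℕ) : Type := Cart m [⋀^Fin k]→L[ℝ] ℝ

instance Alt.finiteDimensional (m k : ℕ) : FiniteDimensional ℝ (Alt m k) := by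
  let f : Alt m k →ₗ[ℝ] MultilinearMap ℝ (fun _ : Fin k => Cart m) ℝ :=
    { toFun := fun a => a.toAlternatingMap.toMultilinearMap
      map_add' := fun _ _ => rfl
      map_smul' := fun _ _ => rfl }
  refine FiniteDimensional.of_injective f ?_
  intro a b h
  ext v
  exact congrArg (fun c : MultilinearMap ℝ (fun _ : Fin k => Cart m) ℝ => c v) h

/-- The wedge product of alternating forms (the sum over shuffles, without normalising factor). -/
noncomputable def Alt.wedgeAux {m p q : ℕ} (a : Alt m p) (b : Alt m q) : Alt m (p + q) :=
  { ((LinearMap.mul' ℝ ℝ).compAlternatingMap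
      (a.toAlternatingMap.domCoprod b.toAlternatingMap)).domDomCongr finSumFinEquiv with
    cont := by
      change Continuous fun v : Fin (p + q) → Cart m => LinearMap.mul' ℝ ℝ
        ((∑ σ : Equiv.Perm.ModSumCongr (Fin p) (Fin q), AlternatingMap.domCoprod.summand
          a.toAlternatingMap b.toAlternatingMap σ) (v ∘ finSumFinEquiv))
      simp only [sum_apply, map_sum]
      refine continuous_finsetSum _ fun σ _ => ?_
      induction σ using Quotient.inductionOn' with | _ σ =>
      change Continuous fun v : Fin (p + q) → Cart m => LinearMap.mul' ℝ ℝ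
        (Equiv.Perm.sign σ • TensorProduct.tmul ℝ
          (a fun i => v (finSumFinEquiv (σ (Sum.inl i))))
          (b fun i => v (finSumFinEquiv (σ (Sum.inr i)))))
      simp only [Units.smul_def, map_zsmul, LinearMap.mul'_apply]
      have ha : Continuous fun v : Fin (p + q) → Cart m =>
          a fun i => v (finSumFinEquiv (σ (Sum.inl i))) :=
        a.cont.comp (continuous_pi fun i => continuous_apply _)
      have hb : Continuous fun v : Fin (p + q) → Cart m =>
          b fun i => v (finSumFinEquiv (σ (Sum.inr i))) :=
        b.cont.comp (continuous_pi fun i => continuous_apply _)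
      simp only [zsmul_eq_mul]
      exact continuous_const.mul (ha.mul hb) }

theorem Alt.wedgeAux_apply {m p q : ℕ} (a : Alt m p) (b : Alt m q) (v : Fin (p + q) → Cart m) :
    Alt.wedgeAux a b v = LinearMap.mul' ℝ ℝ
      (AlternatingMap.domCoprod' (TensorProduct.tmul ℝ a.toAlternatingMap b.toAlternatingMap)
        (v ∘ finSumFinEquiv)) := rfl

/-- The wedge product of alternating forms, as a bilinear map. -/
noncomputable def Alt.wedge (m p q : ℕ) : Alt m p →ₗ[ℝ] Alt m q →ₗ[ℝ] Alt m (p + q) :=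
  LinearMap.mk₂ ℝ Alt.wedgeAux
    (fun a a' b => by
      ext v
      rw [ContinuousAlternatingMap.add_apply]
      simp only [Alt.wedgeAux_apply]
      rw [show (a + a').toAlternatingMap = a.toAlternatingMap + a'.toAlternatingMap from rfl,
        TensorProduct.add_tmul, map_add, AlternatingMap.add_apply, map_add])
    (fun c a b => by
      ext v
      rw [ContinuousAlternatingMap.smul_apply]
      simp only [Alt.wedgeAux_apply]
      rw [show (c • a).toAlternatingMap = c • a.toAlternatingMap from rfl,
        ← TensorProduct.smul_tmul', map_smul, AlternatingMap.smul_apply, map_smul])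
    (fun a b b' => by
      ext v
      rw [ContinuousAlternatingMap.add_apply]
      simp only [Alt.wedgeAux_apply]
      rw [show (b + b').toAlternatingMap = b.toAlternatingMap + b'.toAlternatingMap from rfl,
        TensorProduct.tmul_add, map_add, AlternatingMap.add_apply, map_add])
    (fun c a b => by
      ext v
      rw [ContinuousAlternatingMap.smul_apply]
      simp only [Alt.wedgeAux_apply]
      rw [show (c • b).toAlternatingMap = c • b.toAlternatingMap from rfl,
        TensorProduct.tmul_smul, map_smul, AlternatingMap.smul_apply, map_smul])

theorem Alt.wedge_comp {m m' p q : ℕ} (a : Alt m p) (b : Alt m q) (L : Cart m' →L[ℝ] Cart m) :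
    (Alt.wedge m p q a b).compContinuousLinearMap L = Alt.wedge m' p q
      (a.compContinuousLinearMap L) (b.compContinuousLinearMap L) := by
  ext v
  change LinearMap.mul' ℝ ℝ
        ((∑ σ : Equiv.Perm.ModSumCongr (Fin p) (Fin q), AlternatingMap.domCoprod.summand
          a.toAlternatingMap b.toAlternatingMap σ) ((L ∘ v) ∘ finSumFinEquiv)) =
      LinearMap.mul' ℝ ℝ
        ((∑ σ : Equiv.Perm.ModSumCongr (Fin p) (Fin q), AlternatingMap.domCoprod.summand
          (a.compContinuousLinearMap L).toAlternatingMap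
          (b.compContinuousLinearMap L).toAlternatingMap σ) (v ∘ finSumFinEquiv))
  simp only [sum_apply, map_sum]
  refine Finset.sum_congr rfl fun σ _ => ?_
  induction σ using Quotient.inductionOn' with | _ σ =>
  rfl

theorem contDiff_bilinear {D F G K : Type*} [NormedAddCommGroup D] [NormedSpace ℝ D]
    [NormedAddCommGroup F] [NormedSpace ℝ F] [FiniteDimensional ℝ F]
    [NormedAddCommGroup G] [NormedSpace ℝ G] [FiniteDimensional ℝ G]
    [NormedAddCommGroup K] [NormedSpace ℝ K] (B : F →ₗ[ℝ] G →ₗ[ℝ] K)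
    {a : D → F} {b : D → G} (ha : ContDiff ℝ ∞ a) (hb : ContDiff ℝ ∞ b) :
    ContDiff ℝ ∞ fun x => B (a x) (b x) :=
  ((LinearMap.toContinuousBilinearMap B).contDiff.comp ha).clm_apply hb

theorem Alt.wedge_contDiff {m p q l : ℕ} {a : Cart l → Alt m p} {b : Cart l → Alt m q}
    (ha : ContDiff ℝ ∞ a) (hb : ContDiff ℝ ∞ b) :
    ContDiff ℝ ∞ fun x => Alt.wedge m p q (a x) (b x) :=
  contDiff_bilinear (Alt.wedge m p q) ha hb

/-- Plots of `M`: smooth maps `ℝ^m → M`. -/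
noncomputable abbrev Plot {E : Type v} [NormedAddCommGroup E] [NormedSpace ℝ E] {H : Type w}
    [TopologicalSpace H] (I : ModelWithCorners ℝ E H) (M : Type u) [TopologicalSpace M]
    [ChartedSpace H M] (m : ℕ) : Type u :=
  C^∞⟮𝓘(ℝ, Cart m), Cart m; I, M⟯

section Forms

variable {E : Type*} [NormedAddCommGroup E] [NormedSpace ℝ E] {H : Type*}
    [TopologicalSpace H] (I : ModelWithCorners ℝ E H) (M : Type u) [TopologicalSpace M]
    [ChartedSpace H M]

theorem minSmoothness_le_infty : minSmoothness ℝ 2 ≤ (∞ : WithTop ℕ∞) := by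
  rw [minSmoothness_of_isRCLikeNormedField]
  exact WithTop.coe_le_coe.2 (le_top : (2 : ℕ∞) ≤ ⊤)

/-- Families of smooth `k`-forms on `ℝ^m`, one for each plot `ℝ^m → M`, that are natural under
smooth maps `ℝ^m' → ℝ^m`. -/
noncomputable def formSubmodule (k : ℕ) : Submodule ℝ (∀ m, Plot I M m → Cart m → Alt m k) where
  carrier := {α | (∀ m (p : Plot I M m), ContDiff ℝ ∞ (α m p)) ∧
    ∀ m m' (p : Plot I M m) (f : C^∞⟮𝓘(ℝ, Cart m'), Cart m'; 𝓘(ℝ, Cart m), Cart m⟯) (x : Cart m'),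
      α m' (p.comp f) x = (α m p (f x)).compContinuousLinearMap (fderiv ℝ f x)}
  add_mem' := by
    rintro α β ⟨h1, h2⟩ ⟨h1', h2'⟩
    refine ⟨fun m p => (h1 m p).add (h1' m p), fun _ _ p f x => ?_⟩
    simp only [Pi.add_apply, h2, h2']
    rfl
  zero_mem' := ⟨fun _ _ => contDiff_const, fun _ _ _ _ _ => rfl⟩
  smul_mem' := by
    rintro c α ⟨h1, h2⟩
    refine ⟨fun m p => (h1 m p).const_smul c, fun m m' p f x => ?_⟩
    simp only [Pi.smul_apply, h2]
    rfl

/-- Differential `k`-forms on `M`: natural transformations from plots of `M` to smooth `k`-forms. -/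
def DiffForm (k : ℕ) : Type u := formSubmodule I M k

noncomputable instance (k : ℕ) : AddCommGroup (DiffForm I M k) :=
  inferInstanceAs (AddCommGroup (formSubmodule I M k))

noncomputable instance (k : ℕ) : Module ℝ (DiffForm I M k) :=
  inferInstanceAs (Module ℝ (formSubmodule I M k))

namespace DiffForm
variable {I M}

/-- The pullback of a form along a plot. -/
def onPlot {k : ℕ} (α : DiffForm I M k) {m : ℕ} (p : Plot I M m) : Cart m → Alt m k := α.1 m p

theorem ext {k : ℕ} {α β : DiffForm I M k}
    (h : ∀ m (p : Plot I M m) x, α.onPlot p x = β.onPlot p x) :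
    α = β :=
  Subtype.ext (funext fun m => funext fun p => funext fun x => h m p x)

theorem contDiff {k : ℕ} (α : DiffForm I M k) (m : ℕ) (p : Plot I M m) :
    ContDiff ℝ ∞ (α.onPlot p) := α.2.1 m p

theorem natural {k : ℕ} (α : DiffForm I M k) {m m' : ℕ} (p : Plot I M m)
    (f : C^∞⟮𝓘(ℝ, Cart m'), Cart m'; 𝓘(ℝ, Cart m), Cart m⟯) (x : Cart m') :
    α.onPlot (p.comp f) x = (α.onPlot p (f x)).compContinuousLinearMap (fderiv ℝ f x) :=
  α.2.2 m m' p f x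

theorem differentiable {k : ℕ} (α : DiffForm I M k) (m : ℕ) (p : Plot I M m) :
    Differentiable ℝ (α.onPlot p) := (α.contDiff m p).differentiable (by simp)

variable (I M)

/-- The constant function `1`. -/
noncomputable def one : DiffForm I M 0 :=
  ⟨fun m _ _ => ContinuousAlternatingMap.constOfIsEmpty ℝ (Cart m) (Fin 0) (1 : ℝ),
    fun _ _ => contDiff_const, fun _ _ _ _ _ => rfl⟩

/-- The wedge product of differential forms. -/
noncomputable def wedge (p q : ℕ) :
    DiffForm I M p →ₗ[ℝ] DiffForm I M q →ₗ[ℝ] DiffForm I M (p + q) :=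
  LinearMap.mk₂ ℝ
    (fun α β => ⟨fun m φ x => Alt.wedge m p q (α.onPlot φ x) (β.onPlot φ x),
      fun m φ => Alt.wedge_contDiff (α.contDiff m φ) (β.contDiff m φ),
      fun m m' φ f x => by
        change Alt.wedge m' p q (α.onPlot (φ.comp f) x) (β.onPlot (φ.comp f) x)
          = (Alt.wedge m p q (α.onPlot φ (f x)) (β.onPlot φ (f x))).compContinuousLinearMap
            (fderiv ℝ f x)
        rw [α.natural, β.natural, Alt.wedge_comp]⟩)
    (fun α α' β => DiffForm.ext fun _ _ _ => by exact LinearMap.map_add₂ _ _ _ _)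
    (fun c α β => DiffForm.ext fun _ _ _ => by exact LinearMap.map_smul₂ _ _ _ _)
    (fun α β β' => DiffForm.ext fun _ _ _ => by exact map_add _ _ _)
    (fun c α β => DiffForm.ext fun m φ x => by
      exact map_smul (Alt.wedge m p q (α.onPlot φ x)) c (β.onPlot φ x))

/-- The exterior derivative. -/
noncomputable def d (k : ℕ) : DiffForm I M k →ₗ[ℝ] DiffForm I M (k + 1) where
  toFun α := ⟨fun m p x => extDeriv (α.onPlot p) x,
    fun m p => (ContinuousAlternatingMap.alternatizeUncurryFinCLM (n := k) ℝ (Cart m) ℝ).contDiff.comp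
      ((α.contDiff m p).fderiv_right (by simp)),
    fun m m' p f x => by
      have hf : ContDiff ℝ ∞ f := f.contMDiff.contDiff
      have h : α.onPlot (p.comp f)
          = fun x => (α.onPlot p (f x)).compContinuousLinearMap (fderiv ℝ f x) :=
        funext fun x => α.natural p f x
      change extDeriv (α.onPlot (p.comp f)) x = _
      rw [h]
      exact extDeriv_pullback (r := ∞) (α.differentiable m p (f x)) hf.contDiffAt
        (minSmoothness_le_infty)⟩
  map_add' α β := by
    refine DiffForm.ext fun m p x => ?_
    exact extDeriv_add (α.differentiable m p x) (β.differentiable m p x)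
  map_smul' c α := by
    refine DiffForm.ext fun m p x => ?_
    exact extDeriv_smul c (α.onPlot p)

theorem d_d (k : ℕ) (α : DiffForm I M k) : d I M (k + 1) (d I M k α) = 0 := by
  refine DiffForm.ext fun m p x => ?_
  exact congrFun (extDeriv_extDeriv (α.contDiff m p) minSmoothness_le_infty) x

end DiffForm

/-- The de Rham algebra `Ω(M)`. -/
noncomputable def deRham : DGData.{u} where
  obj k := DiffForm I M k
  one := DiffForm.one I M
  mul := DiffForm.wedge I M
  d := DiffForm.d I M
  d_d := DiffForm.d_d I M

end Forms

section Pullback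

variable {E : Type*} [NormedAddCommGroup E] [NormedSpace ℝ E] {H : Type*}
    [TopologicalSpace H] {I : ModelWithCorners ℝ E H} {M : Type u} [TopologicalSpace M]
    [ChartedSpace H M]
    {E' : Type*} [NormedAddCommGroup E'] [NormedSpace ℝ E'] {H' : Type*}
    [TopologicalSpace H'] {I' : ModelWithCorners ℝ E' H'} {M' : Type v} [TopologicalSpace M']
    [ChartedSpace H' M']

/-- Pullback of differential forms along a smooth map. -/
noncomputable def DiffForm.pullback (f : C^∞⟮I, M; I', M'⟯) (k : ℕ) :
    DiffForm I' M' k →ₗ[ℝ] DiffForm I M k where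
  toFun α := ⟨fun _ p => α.onPlot (f.comp p), fun m p => α.contDiff m (f.comp p),
    fun _ _ p h x => α.natural (f.comp p) h x⟩
  map_add' _ _ := rfl
  map_smul' _ _ := rfl

/-- Pullback as a morphism of de Rham algebras. -/
noncomputable def deRhamPullback (f : C^∞⟮I, M; I', M'⟯) : DGHom (deRham I' M') (deRham I M) where
  toLin := DiffForm.pullback f
  map_one := rfl
  map_mul _ _ _ _ := rfl
  map_d _ _ := rfl

/-! ### Vertical forms -/

variable {B : Type*}

/-- The forms on `M` that vanish on each fibre of `π : M → B`, i.e. whose pullback along every plot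
that stays in one fibre is zero. For a submersion `π`, these are the forms that vanish when all
their arguments are vertical vectors, i.e. tangent to the fibres. -/
noncomputable def fibrewiseZero (I : ModelWithCorners ℝ E H) (π : M → B) (k : ℕ) :
    Submodule ℝ (DiffForm I M k) where
  carrier := {α | ∀ m (p : Plot I M m), (∀ x y, π (p x) = π (p y)) → α.onPlot p = 0}
  add_mem' := by
    intro α β h h' m p hp
    change α.onPlot p + β.onPlot p = 0
    rw [h m p hp, h' m p hp, add_zero]
  zero_mem' _ _ _ := rfl
  smul_mem' := by
    intro c α h m p hp
    change c • α.onPlot p = 0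
    rw [h m p hp, smul_zero]

variable (I)

/-- The algebra of vertical forms `Ω_vert(M)` for `π : M → B`: the quotient of `Ω(M)` by the forms
that vanish on vertical vectors. -/
noncomputable def verticalDeRham (π : M → B) : DGData.{u} where
  obj k := DiffForm I M k ⧸ fibrewiseZero I π k
  one := Submodule.Quotient.mk (DiffForm.one I M)
  mul p q := Submodule.liftQ _
    (LinearMap.flip (Submodule.liftQ _
      (LinearMap.flip ((DiffForm.wedge I M p q).compr₂ (Submodule.mkQ _))) (by
        intro β hβ
        ext1 α
        refine (Submodule.Quotient.mk_eq_zero _).2 ?_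
        intro m φ hφ
        funext x
        change Alt.wedge m p q (α.onPlot φ x) (β.onPlot φ x) = 0
        rw [hβ m φ hφ]
        exact map_zero _))) (by
    intro α hα
    ext β
    refine (Submodule.Quotient.mk_eq_zero _).2 ?_
    intro m φ hφ
    funext x
    change Alt.wedge m p q (α.onPlot φ x) (β.onPlot φ x) = 0
    rw [hα m φ hφ]
    exact LinearMap.map_zero₂ _ _)
  d k := Submodule.mapQ _ _ (DiffForm.d I M k) (by
    intro α hα m φ hφ
    funext x
    change extDeriv (α.onPlot φ) x = 0
    rw [hα m φ hφ]
    change ContinuousAlternatingMap.alternatizeUncurryFin (fderiv ℝ (0 : Cart m → Alt m k) x) = 0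
    rw [fderiv_zero]
    exact map_zero (ContinuousAlternatingMap.alternatizeUncurryFinCLM (n := k) ℝ (Cart m) ℝ))
  d_d k x := by
    induction x using Submodule.Quotient.induction_on with | _ α =>
    refine congrArg Submodule.Quotient.mk (DiffForm.d_d I M k α)

/-- The projection `Ω(M) → Ω_vert(M)`. -/
noncomputable def restrictVertical (π : M → B) : DGHom (deRham I M) (verticalDeRham I π) where
  toLin k := Submodule.mkQ (fibrewiseZero I π k)
  map_one := rfl
  map_mul _ _ _ _ := rfl
  map_d _ _ := rfl

variable {I}

/-- Pullback of vertical forms along a smooth map that sends fibres into fibres. -/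
noncomputable def verticalPullback {B' : Type*} (f : C^∞⟮I, M; I', M'⟯) (π : M → B) (π' : M' → B')
    (hf : ∀ x y, π x = π y → π' (f x) = π' (f y)) :
    DGHom (verticalDeRham I' π') (verticalDeRham I π) where
  toLin k := Submodule.mapQ _ _ (DiffForm.pullback f k)
    (fun α hα m p hp => hα m (f.comp p) fun x y => hf _ _ (hp x y))
  map_one := rfl
  map_mul p q x y := by
    induction x using Submodule.Quotient.induction_on with | _ α =>
    induction y using Submodule.Quotient.induction_on with | _ β =>
    rfl
  map_d k x := by
    induction x using Submodule.Quotient.induction_on with | _ α =>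
    rfl

end Pullback

/-! ### Connection descent objects -/

section Maps

variable {E : Type*} [NormedAddCommGroup E] [NormedSpace ℝ E] {H : Type*}
    [TopologicalSpace H] {I : ModelWithCorners ℝ E H} {M : Type u} [TopologicalSpace M]
    [ChartedSpace H M]
    {E' : Type*} [NormedAddCommGroup E'] [NormedSpace ℝ E'] {H' : Type*}
    [TopologicalSpace H'] {I' : ModelWithCorners ℝ E' H'} {M' : Type v} [TopologicalSpace M']
    [ChartedSpace H' M']

variable (I M) in
/-- The inclusion `M → M × [0,1]`, `x ↦ (x, t)`. -/
noncomputable def atTime (t : Set.Icc (0 : ℝ) 1) :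
    C^∞⟮I, M; I.prod (𝓡∂ 1), M × Set.Icc (0 : ℝ) 1⟯ :=
  ⟨fun x => (x, t), contMDiff_id.prodMk contMDiff_const⟩

/-- The map `f × id : M × [0,1] → M' × [0,1]`. -/
noncomputable def timesInterval (f : C^∞⟮I, M; I', M'⟯) :
    C^∞⟮I.prod (𝓡∂ 1), M × Set.Icc (0 : ℝ) 1; I'.prod (𝓡∂ 1), M' × Set.Icc (0 : ℝ) 1⟯ :=
  ⟨fun x => (f x.1, x.2), (f.contMDiff.comp contMDiff_fst).prodMk contMDiff_snd⟩

/-- A form on `M × [0,1]` has no component along `dt`: it vanishes as soon as one of its arguments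
projects to zero on `M`. -/
def NoIntervalPart {k : ℕ} (α : DiffForm (I.prod (𝓡∂ 1)) (M × Set.Icc (0 : ℝ) 1) k) : Prop :=
  ∀ (m : ℕ) (p : Plot (I.prod (𝓡∂ 1)) (M × Set.Icc (0 : ℝ) 1) m) (x : Cart m)
    (v : Fin k → Cart m) (j : Fin k),
    mfderiv 𝓘(ℝ, Cart m) I (fun y => (p y).1) x (v j) = 0 → α.onPlot p x v = 0

end Maps

section Descent

variable (g : LInfinityAlgebra.{u})
  {n : ℕ} {X : Type v} [TopologicalSpace X] [ChartedSpace (EuclideanSpace ℝ (Fin n)) X]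
  {m : ℕ} {Y : Type w} [TopologicalSpace Y] [ChartedSpace (EuclideanSpace ℝ (Fin m)) Y]

/-- A `g`-connection descent object on `π : Y → X`: a commuting diagram
`CE(g) → Ω_vert(Y)`, `W(g) → Ω(Y)`, `inv(g) → Ω(X)` of differential graded algebras over the
canonical maps `CE(g) ← W(g) ← inv(g)` and `Ω_vert(Y) ← Ω(Y) ← Ω(X)`. -/
structure ConnectionDescent (π : C^∞⟮𝓡 m, Y; 𝓡 n, X⟯) where
  Avert : DGHom g.CE (verticalDeRham (𝓡 m) π)
  A : DGHom g.W (deRham (𝓡 m) Y)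
  K : DGHom g.inv (deRham (𝓡 n) X)
  top : (restrictVertical (𝓡 m) π).comp A = Avert.comp g.WtoCE
  bottom : (deRhamPullback π).comp K = A.comp g.invToW

namespace ConnectionDescent

variable {g} {π : C^∞⟮𝓡 m, Y; 𝓡 n, X⟯}

/-- The characteristic forms of a descent object: the family `P ↦ K(P)` of forms on `X`, indexed by
the elements `P` of `inv(g)`. -/
def charForms (D : ConnectionDescent g π) (k : ℕ) : g.inv.obj k →ₗ[ℝ] DiffForm (𝓡 n) X k :=
  D.K.toLin k

/-- The characteristic classes of a descent object: the map `H^k(inv(g)) → H^k_dR(X)`. -/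
noncomputable def charClasses (D : ConnectionDescent g π) (k : ℕ) :
    g.inv.Cohomology k →ₗ[ℝ] (deRham (𝓡 n) X).Cohomology k :=
  D.K.mapCohomology k

/-- The pullback along a map `f : Z → Y` over `X`. -/
noncomputable def pullback (D : ConnectionDescent g π)
    {l : ℕ} {Z : Type*} [TopologicalSpace Z] [ChartedSpace (EuclideanSpace ℝ (Fin l)) Z]
    {ρ : C^∞⟮𝓡 l, Z; 𝓡 n, X⟯} (f : C^∞⟮𝓡 l, Z; 𝓡 m, Y⟯) (hf : ∀ z, π (f z) = ρ z) :
    ConnectionDescent g ρ where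
  Avert := (verticalPullback f ρ π fun x y h => by rw [hf, hf, h]).comp D.Avert
  A := (deRhamPullback f).comp D.A
  K := D.K
  top := by
    have h := D.top
    simp only [DGHom.comp, DGHom.mk.injEq] at h ⊢
    funext k
    have hk := congrFun h k
    refine LinearMap.ext fun x => ?_
    have hx := LinearMap.congr_fun hk x
    exact congrArg ((verticalPullback f ρ π fun x y h => by rw [hf, hf, h]).toLin k) hx
  bottom := by
    have h := D.bottom
    have hρ : ρ = π.comp f := ContMDiffMap.ext fun z => (hf z).symm
    subst hρ
    simp only [DGHom.comp, DGHom.mk.injEq] at h ⊢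
    funext k
    have hk := congrFun h k
    refine LinearMap.ext fun x => ?_
    have hx := LinearMap.congr_fun hk x
    exact congrArg ((deRhamPullback f).toLin k) hx

end ConnectionDescent

variable {g}

/-- A concordance between two descent objects on the same `π : Y → X`: a commuting diagram of the
same shape with values in the forms on `Y × [0,1]` and `X × [0,1]`, which restricts to the two
objects at the times `0` and `1`, in all three rows. -/
structure Concordance {π : C^∞⟮𝓡 m, Y; 𝓡 n, X⟯} (D D' : ConnectionDescent g π) where
  ηvert : DGHom g.CE (verticalDeRham ((𝓡 m).prod (𝓡∂ 1))
    fun z : Y × Set.Icc (0 : ℝ) 1 => π z.1)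
  η : DGHom g.W (deRham ((𝓡 m).prod (𝓡∂ 1)) (Y × Set.Icc (0 : ℝ) 1))
  κ : DGHom g.inv (deRham ((𝓡 n).prod (𝓡∂ 1)) (X × Set.Icc (0 : ℝ) 1))
  top : (restrictVertical ((𝓡 m).prod (𝓡∂ 1)) _).comp η = ηvert.comp g.WtoCE
  bottom : (deRhamPullback (timesInterval π)).comp κ = η.comp g.invToW
  source_vert : (verticalPullback (atTime (𝓡 m) Y 0) π _ fun _ _ h => h).comp ηvert = D.Avert
  source : (deRhamPullback (atTime (𝓡 m) Y 0)).comp η = D.A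
  source_base : (deRhamPullback (atTime (𝓡 n) X 0)).comp κ = D.K
  target_vert : (verticalPullback (atTime (𝓡 m) Y 1) π _ fun _ _ h => h).comp ηvert = D'.Avert
  target : (deRhamPullback (atTime (𝓡 m) Y 1)).comp η = D'.A
  target_base : (deRhamPullback (atTime (𝓡 n) X 1)).comp κ = D'.K

/-- A concordance is vertical, i.e. a gauge transformation, if it sends the shifted generators
`g^*[1]` of the Weil algebra to forms without component along `dt`. -/
def Concordance.IsVertical {π : C^∞⟮𝓡 m, Y; 𝓡 n, X⟯} {D D' : ConnectionDescent g π}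
    (c : Concordance D D') : Prop :=
  ∀ (k : ℕ+) (a : Module.Dual ℝ (g.space k)),
    NoIntervalPart (c.η.toLin (k + 1) ⟨g.shifted k a, g.shifted_mem k a⟩)

variable {m' : ℕ} {Y' : Type*} [TopologicalSpace Y'] [ChartedSpace (EuclideanSpace ℝ (Fin m')) Y']

/-- A common refinement of `π : Y → X` and `π' : Y' → X`: a surjective submersion `Z → X` with smooth
maps `Z → Y` and `Z → Y'` over `X`. -/
structure CommonRefinement (π : C^∞⟮𝓡 m, Y; 𝓡 n, X⟯) (π' : C^∞⟮𝓡 m', Y'; 𝓡 n, X⟯) where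
  dim : ℕ
  Z : Type t
  [topologicalSpace : TopologicalSpace Z]
  [chartedSpace : ChartedSpace (EuclideanSpace ℝ (Fin dim)) Z]
  [isManifold : IsManifold (𝓡 dim) ∞ Z]
  proj : C^∞⟮𝓡 dim, Z; 𝓡 n, X⟯
  surjective : Function.Surjective proj
  submersion : Manifold.IsSubmersion (𝓡 dim) (𝓡 n) ∞ proj
  left : C^∞⟮𝓡 dim, Z; 𝓡 m, Y⟯
  right : C^∞⟮𝓡 dim, Z; 𝓡 m', Y'⟯
  left_over : ∀ z, π (left z) = proj z
  right_over : ∀ z, π' (right z) = proj z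

attribute [instance] CommonRefinement.topologicalSpace CommonRefinement.chartedSpace
  CommonRefinement.isManifold

variable {π : C^∞⟮𝓡 m, Y; 𝓡 n, X⟯} {π' : C^∞⟮𝓡 m', Y'; 𝓡 n, X⟯}

/-- Two descent objects are concordant if there is a concordance between their pullbacks to some
common refinement. -/
def Concordant (D : ConnectionDescent g π) (D' : ConnectionDescent g π') : Prop :=
  ∃ R : CommonRefinement.{t} π π',
    Nonempty (Concordance (D.pullback R.left R.left_over) (D'.pullback R.right R.right_over))

/-- Two descent objects are related by a gauge transformation if there is a vertical concordance
between their pullbacks to some common refinement. -/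
def GaugeEquivalent (D : ConnectionDescent g π) (D' : ConnectionDescent g π') : Prop :=
  ∃ (R : CommonRefinement.{t} π π')
    (c : Concordance (D.pullback R.left R.left_over) (D'.pullback R.right R.right_over)),
    c.IsVertical

end Descent

/-! ### Integrals depending on a parameter -/

section ParametricIntegral

open MeasureTheory

variable {E : Type} [NormedAddCommGroup E] [NormedSpace ℝ E] [FiniteDimensional ℝ E]

/-! Passing to a common refinement does not change `K`, so both claims concern one concordance
`(ηvert, η, κ)`.

Classes. For closed `P`, `κ(P)` is a closed form on `X × [0,1]` that restricts to `K(P)` and `K'(P)`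
at the two ends. Integration along `[0,1]` satisfies `d ∫ α = α|₁ - α|₀` for closed `α`
(`DiffForm.d_fibreIntegral`), so the two restrictions are cohomologous. In degree `0` a closed form
is constant in `t`, and the restrictions are equal.

Forms. An element of the Weil algebra that all contractions annihilate is a polynomial in the
shifted generators (`LInfinityAlgebra.horizontal_eq_self`): the derivation that counts unshifted
generators equals `∑ aʲ ι_j`, hence kills the element, and its kernel is the subalgebra generated by
the shifted ones. A vertical concordance sends shifted generators to forms without `dt` component,
and products of such forms have none either. An invariant `P` and its differential `d_W P` are both
annihilated by the contractions, so neither `η(P)` nor `dη(P) = η(d_W P)` has a `dt` component. By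
Cartan's formula `∂ₜ = ι d + d ι`, where `ι` contracts with `∂/∂t`, the form `η(P)` does not depend
on `t`. Its end values are the pullbacks of `K(P)` and `K'(P)` to the total space of the refinement,
and pullback along a surjective submersion is injective (`DiffForm.pullback_injective`).

A form here is a natural family of forms on plots `ℝ^m → M`. Computations on `M × [0,1]` therefore
take place on the cylinder plots `p × s : ℝ^m × ℝ → M × [0,1]`, where `s` is a smooth step with `s 0
= 0` and `s 1 = 1`; there everything reduces to calculus in a fixed direction. -/

theorem hasFDerivAt_intervalIntegral_of_contDiff {F : Type} [NormedAddCommGroup F]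
    [NormedSpace ℝ F] {G : E × ℝ → F} (hG : ContDiff ℝ 1 G) (a b : ℝ) (x : E) :
    HasFDerivAt (fun x => ∫ t in a..b, G (x, t))
      (∫ t in a..b, (fderiv ℝ G (x, t)).comp (ContinuousLinearMap.inl ℝ E ℝ)) x := by
  have hG' : Continuous fun z : E × ℝ => (fderiv ℝ G z).comp (ContinuousLinearMap.inl ℝ E ℝ) :=
    (hG.continuous_fderiv (by simp)).clm_comp continuous_const
  -- Closed balls are compact in finite dimension, so the derivative is bounded on ball × interval,
  -- and a constant serves as the dominating function.
  obtain ⟨C, hC⟩ := ((isCompact_closedBall x 1).prod (isCompact_uIcc (a := a) (b := b))).exists_bound_of_continuousOn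
    hG'.continuousOn
  refine intervalIntegral.hasFDerivAt_integral_of_dominated_of_fderiv_le (𝕜 := ℝ)
    (F := fun x t => G (x, t)) (bound := fun _ => C)
    (F' := fun x t => (fderiv ℝ G (x, t)).comp (ContinuousLinearMap.inl ℝ E ℝ))
    (Metric.closedBall_mem_nhds x one_pos) ?_ ?_ ?_ ?_ ?_ ?_
  · exact .of_forall fun y => (hG.continuous.comp (by fun_prop)).aestronglyMeasurable
  · exact (hG.continuous.comp (by fun_prop)).intervalIntegrable _ _
  · exact (hG'.comp (by fun_prop)).aestronglyMeasurable
  · exact .of_forall fun t ht y hy => hC (y, t) ⟨hy, Set.uIoc_subset_uIcc ht⟩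
  · exact intervalIntegrable_const
  · refine .of_forall fun t _ y _ => ?_
    exact ((hG.differentiable (by simp)) (y, t)).hasFDerivAt.comp y
      (hasFDerivAt_prodMk_left y t)

theorem fderiv_intervalIntegral_apply {F : Type} [NormedAddCommGroup F] [NormedSpace ℝ F]
    [CompleteSpace F] {G : E × ℝ → F} (hG : ContDiff ℝ 1 G) (a b : ℝ) (x u : E) (L : F →L[ℝ] ℝ) :
    L (fderiv ℝ (fun x => ∫ t in a..b, G (x, t)) x u) = ∫ t in a..b, L (fderiv ℝ G (x, t) (u, 0)) := by
  rw [(hasFDerivAt_intervalIntegral_of_contDiff hG a b x).fderiv]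
  have hc : Continuous fun t : ℝ => (fderiv ℝ G (x, t)).comp (ContinuousLinearMap.inl ℝ E ℝ) :=
    ((hG.continuous_fderiv (by simp)).comp (by fun_prop)).clm_comp continuous_const
  exact ((L.comp (ContinuousLinearMap.apply ℝ F u)).intervalIntegral_comp_comm
    (hc.intervalIntegrable a b)).symm

/-- The derivative of a parametric integral is again one, with values in `E →L[ℝ] F`; hence the
induction on the order of differentiability varies `F`. -/
theorem contDiff_intervalIntegral {F : Type} [NormedAddCommGroup F]
    [NormedSpace ℝ F] {G : E × ℝ → F} (hG : ContDiff ℝ ∞ G) (a b : ℝ) :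
    ContDiff ℝ ∞ fun x => ∫ t in a..b, G (x, t) := by
  rw [contDiff_infty]
  intro n
  induction n generalizing F with
  | zero =>
    refine contDiff_zero.2 (continuous_iff_continuousAt.2 fun x => ?_)
    exact (hasFDerivAt_intervalIntegral_of_contDiff (hG.of_le (by simp)) a b x).continuousAt
  | succ n ih =>
    have h := hasFDerivAt_intervalIntegral_of_contDiff (hG.of_le (by simp)) a b
    have e : ((n + 1 : ℕ) : WithTop ℕ∞) = (n : WithTop ℕ∞) + 1 := by norm_cast
    rw [e, contDiff_succ_iff_fderiv]
    refine ⟨fun x => (h x).differentiableAt, by simp, ?_⟩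
    rw [show fderiv ℝ (fun x => ∫ t in a..b, G (x, t)) = _ from funext fun x => (h x).fderiv]
    exact ih ((hG.fderiv_right (by simp)).clm_comp contDiff_const)

end ParametricIntegral

/-! ### The Cartan formula in a fixed direction -/

section Cartan

variable {E F : Type*} [NormedAddCommGroup E] [NormedSpace ℝ E] [NormedAddCommGroup F]
  [NormedSpace ℝ F]

/-- Cartan's formula `ι_e dβ = ∂_e β - d(ι_e β)` for the constant vector field `e`. The first
summand of the alternating sum differentiates along `e`; the others keep `e` as first argument and
make up `d(ι_e β)`. -/
theorem extDeriv_vecCons {k : ℕ} (β : E → E [⋀^Fin (k + 1)]→L[ℝ] F) (y e : E)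
    (v : Fin (k + 1) → E) :
    extDeriv β y (Matrix.vecCons e v) = fderiv ℝ β y e v
      - ∑ i : Fin (k + 1), (-1) ^ (i : ℕ) •
        fderiv ℝ β y (v i) (Matrix.vecCons e (Fin.removeNth i v)) := by
  rw [extDeriv, ContinuousAlternatingMap.alternatizeUncurryFin_apply, Fin.sum_univ_succ,
    sub_eq_add_neg, ← Finset.sum_neg_distrib]
  congr 1
  · simp [Matrix.vecCons]
  · refine Finset.sum_congr rfl fun i _ => ?_
    have h : Fin.removeNth i.succ (Matrix.vecCons e v) = Matrix.vecCons e (Fin.removeNth i v) := by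
      cases k with
      | zero => obtain rfl := Fin.fin_one_eq_zero i; ext j; fin_cases j; rfl
      | succ k =>
        ext j
        cases j using Fin.cases with
        | zero => simp [Fin.removeNth_apply]
        | succ j => simp [Fin.removeNth_apply, Fin.succ_succAbove_succ]
    rw [h, Matrix.cons_val_succ, Fin.val_succ, pow_succ]
    simp

/-- Cartan's formula in degree `0`, where the term `d(ι_e β)` is absent. -/
theorem extDeriv_vecCons_zero (β : E → E [⋀^Fin 0]→L[ℝ] F) (y e : E) (v : Fin 0 → E) :
    extDeriv β y (Matrix.vecCons e v) = fderiv ℝ β y e v := by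
  rw [extDeriv, ContinuousAlternatingMap.alternatizeUncurryFin_apply]
  simp only [Fin.sum_univ_succ, Fin.val_zero, pow_zero, one_smul, Finset.univ_eq_empty,
    Finset.sum_empty, add_zero]
  simp [Subsingleton.elim (Fin.removeNth 0 (Matrix.vecCons e v)) v]

end Cartan

/-! ### Forms on `ℝ^m × ℝ` -/

namespace Cart

/-- `ℝ^(m+1)` as a product `ℝ^m × ℝ`. -/
noncomputable def split (m : ℕ) : Cart (m + 1) ≃L[ℝ] Cart m × ℝ :=
  -- An unspecified isomorphism, given by equality of dimensions: only its being linear and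
  -- invertible matters, and `inl` and `dt` are defined through it.
  ContinuousLinearEquiv.ofFinrankEq (by simp)

/-- The inclusion `ℝ^m → ℝ^m × ℝ` of the first factor. -/
noncomputable def inl (m : ℕ) : Cart m →L[ℝ] Cart (m + 1) :=
  ((split m).symm : Cart m × ℝ →L[ℝ] Cart (m + 1)).comp (ContinuousLinearMap.inl ℝ (Cart m) ℝ)

/-- The unit vector in the direction of the last factor of `ℝ^m × ℝ`. -/
noncomputable def dt (m : ℕ) : Cart (m + 1) := (split m).symm (0, 1)

theorem split_symm_mk (m : ℕ) (x : Cart m) (t : ℝ) :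
    (split m).symm (x, t) = inl m x + t • dt m := by
  rw [inl, dt, ← map_smul]
  change _ = (split m).symm (x, 0) + _
  rw [← map_add]
  simp

theorem hasFDerivAt_split_symm_mk (m : ℕ) (x : Cart m) (t : ℝ) :
    HasFDerivAt (fun x => (split m).symm (x, t)) (inl m) x := by
  simp only [split_symm_mk]
  exact (inl m).hasFDerivAt.add_const _

theorem hasDerivAt_split_symm_mk (m : ℕ) (x : Cart m) (t : ℝ) :
    HasDerivAt (fun t => (split m).symm (x, t)) (dt m) t := by
  simp only [split_symm_mk]
  simpa using ((hasDerivAt_id t).smul_const (dt m)).const_add (inl m x)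

end Cart

namespace Alt

open Cart

/-- The contraction of a form on `ℝ^m × ℝ` with `∂/∂t`, restricted to `ℝ^m`. -/
noncomputable def contractTime (m k : ℕ) : Alt (m + 1) (k + 1) →L[ℝ] Alt m k :=
  LinearMap.toContinuousLinearMap
    { toFun := fun a => (a.curryLeft (dt m)).compContinuousLinearMap (Cart.inl m)
      map_add' := fun _ _ => rfl
      map_smul' := fun _ _ => rfl }

/-- Evaluation of alternating forms at given vectors. -/
noncomputable def evalAt {m k : ℕ} (v : Fin k → Cart m) : Alt m k →L[ℝ] ℝ :=
  LinearMap.toContinuousLinearMap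
    { toFun := fun a => a v
      map_add' := fun _ _ => rfl
      map_smul' := fun _ _ => rfl }

/-- The integral over `0 ≤ t ≤ 1` of the contraction of a form with `∂/∂t`. -/
noncomputable def fibreIntegral {m k : ℕ} (β : Cart (m + 1) → Alt (m + 1) (k + 1)) (x : Cart m) :
    Alt m k :=
  ∫ t in (0 : ℝ)..1, contractTime m k (β ((split m).symm (x, t)))

section
variable {m k : ℕ}

theorem contDiff_contractTime {β : Cart (m + 1) → Alt (m + 1) (k + 1)} (hβ : ContDiff ℝ ∞ β) :
    ContDiff ℝ ∞ fun z : Cart m × ℝ => contractTime m k (β ((split m).symm z)) :=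
  (contractTime m k).contDiff.comp (hβ.comp (split m).symm.contDiff)

theorem contDiff_fibreIntegral {β : Cart (m + 1) → Alt (m + 1) (k + 1)} (hβ : ContDiff ℝ ∞ β) :
    ContDiff ℝ ∞ (fibreIntegral β) :=
  contDiff_intervalIntegral (contDiff_contractTime hβ) 0 1

/-- Differentiation under the integral sign. The contraction is linear with constant coefficients,
so the derivative falls on `β` alone, in the directions of `ℝ^m`. -/
theorem fderiv_fibreIntegral_apply {β : Cart (m + 1) → Alt (m + 1) (k + 1)}
    (hβ : ContDiff ℝ ∞ β) (x u : Cart m) (v : Fin k → Cart m) :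
    fderiv ℝ (fibreIntegral β) x u v = ∫ t in (0 : ℝ)..1,
      fderiv ℝ β ((split m).symm (x, t)) (Cart.inl m u)
        (Matrix.vecCons (dt m) fun i => Cart.inl m (v i)) := by
  have hG := contDiff_contractTime hβ
  refine (fderiv_intervalIntegral_apply (hG.of_le (by simp)) 0 1 x u (evalAt v)).trans ?_
  refine intervalIntegral.integral_congr fun t _ => ?_
  have h1 : HasFDerivAt (fun z : Cart m × ℝ => contractTime m k (β ((split m).symm z)))
      ((contractTime m k).comp ((fderiv ℝ β ((split m).symm (x, t))).comp
        ((split m).symm : Cart m × ℝ →L[ℝ] Cart (m + 1)))) (x, t) :=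
    (contractTime m k).hasFDerivAt.comp _
      (((hβ.differentiable (by simp)) _).hasFDerivAt.comp _ (split m).symm.hasFDerivAt)
  exact congrArg (fun L => evalAt v (L (u, 0))) h1.fderiv

theorem hasDerivAt_apply {β : Cart (m + 1) → Alt (m + 1) k} (hβ : ContDiff ℝ ∞ β) (x : Cart m)
    (t : ℝ) (v : Fin k → Cart (m + 1)) :
    HasDerivAt (fun t => β ((split m).symm (x, t)) v)
      (fderiv ℝ β ((split m).symm (x, t)) (dt m) v) t :=
  (evalAt v).hasFDerivAt.comp_hasDerivAt t
    (((hβ.differentiable (by simp)) _).hasFDerivAt.comp_hasDerivAt t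
      (hasDerivAt_split_symm_mk m x t))

/-- The homotopy formula for closed forms. -/
theorem extDeriv_fibreIntegral {β : Cart (m + 1) → Alt (m + 1) (k + 1)} (hβ : ContDiff ℝ ∞ β)
    (hd : ∀ y, extDeriv β y = 0) (x : Cart m) :
    extDeriv (fibreIntegral β) x
      = (β ((split m).symm (x, 1))).compContinuousLinearMap (Cart.inl m)
        - (β ((split m).symm (x, 0))).compContinuousLinearMap (Cart.inl m) := by
  ext v
  have hc : ∀ (u : Cart (m + 1)) (w : Fin (k + 1) → Cart (m + 1)),
      Continuous fun t : ℝ => fderiv ℝ β ((split m).symm (x, t)) u w := fun u w =>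
    (evalAt w).continuous.comp ((((hβ.continuous_fderiv (by simp)).comp
      ((split m).symm.continuous.comp (by fun_prop))).clm_apply continuous_const))
  rw [extDeriv, ContinuousAlternatingMap.alternatizeUncurryFin_apply]
  simp only [fderiv_fibreIntegral_apply hβ, zsmul_eq_mul, Int.cast_pow, Int.cast_neg, Int.cast_one]
  simp only [← intervalIntegral.integral_const_mul]
  rw [← intervalIntegral.integral_finsetSum fun i _ =>
    ((hc _ _).const_mul _).intervalIntegrable _ _]
  change _ = β ((split m).symm (x, 1)) (Cart.inl m ∘ v) - β ((split m).symm (x, 0)) (Cart.inl m ∘ v)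
  -- The difference of the end values is the integral of `∂ₜβ`, so it suffices to compare
  -- integrands.
  rw [← intervalIntegral.integral_eq_sub_of_hasDerivAt
    (fun t _ => hasDerivAt_apply hβ x t (Cart.inl m ∘ v)) ((hc _ _).intervalIntegrable _ _)]
  refine intervalIntegral.integral_congr fun t _ => ?_
  -- Since `dβ = 0`, Cartan's formula along `dt` reads `∂ₜβ = d(ι β)`, which is the required
  -- equality of integrands.
  have h := extDeriv_vecCons β ((split m).symm (x, t)) (dt m) (Cart.inl m ∘ v)
  rw [hd] at h
  change (0 : ℝ) = _ at h
  simp only [zsmul_eq_mul, Int.cast_pow, Int.cast_neg, Int.cast_one] at h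
  exact (sub_eq_zero.1 h.symm).symm

theorem compContinuousLinearMap_inl_eq_of_fderiv_dt {β : Cart (m + 1) → Alt (m + 1) k}
    (hβ : ContDiff ℝ ∞ β) (x : Cart m)
    (h : ∀ (t : ℝ) (v : Fin k → Cart (m + 1)), fderiv ℝ β ((split m).symm (x, t)) (dt m) v = 0)
    (s t : ℝ) :
    (β ((split m).symm (x, s))).compContinuousLinearMap (Cart.inl m)
      = (β ((split m).symm (x, t))).compContinuousLinearMap (Cart.inl m) := by
  ext v
  exact is_const_of_deriv_eq_zero
    (fun t => (hasDerivAt_apply hβ x t (Cart.inl m ∘ v)).differentiableAt)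
    (fun t => (hasDerivAt_apply hβ x t (Cart.inl m ∘ v)).deriv.trans (h t _)) s t

/-- A form `β` such that `β` and `dβ` have no component along `dt` does not depend on `t`. -/
theorem fderiv_dt_eq_zero {β : Cart (m + 1) → Alt (m + 1) k} (hβ : ContDiff ℝ ∞ β)
    (h : ∀ (y : Cart (m + 1)) (v : Fin k → Cart (m + 1)) (j : Fin k), v j = dt m → β y v = 0)
    (hd : ∀ (y : Cart (m + 1)) (v : Fin k → Cart (m + 1)),
      extDeriv β y (Matrix.vecCons (dt m) v) = 0)
    (y : Cart (m + 1)) (v : Fin k → Cart (m + 1)) : fderiv ℝ β y (dt m) v = 0 := by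
  cases k with
  | zero => rw [← extDeriv_vecCons_zero, hd]
  | succ k =>
    have h1 := extDeriv_vecCons β y (dt m) v
    -- In Cartan's formula the left side vanishes by `hd`. Each term of `d(ι β)` is a derivative of
    -- the identically zero function `β(dt, …)`.
    rw [hd, Finset.sum_eq_zero, sub_zero] at h1
    · exact h1.symm
    · intro i _
      have h2 : HasFDerivAt (fun y => β y (Matrix.vecCons (dt m) (Fin.removeNth i v)))
          ((evalAt (Matrix.vecCons (dt m) (Fin.removeNth i v))).comp (fderiv ℝ β y)) y :=
        (evalAt _).hasFDerivAt.comp y ((hβ.differentiable (by simp)) y).hasFDerivAt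
      have h3 : (fun y => β y (Matrix.vecCons (dt m) (Fin.removeNth i v))) = fun _ => 0 :=
        funext fun y => h y _ 0 rfl
      rw [h3] at h2
      have h4 := congrArg (fun L : Cart (m + 1) →L[ℝ] ℝ => L (v i))
        (h2.unique (hasFDerivAt_const (0 : ℝ) y))
      have h5 : fderiv ℝ β y (v i) (Matrix.vecCons (dt m) (Fin.removeNth i v)) = 0 := h4
      rw [h5, smul_zero]

end

end Alt

/-! ### Horizontal elements of the Weil algebra -/

namespace LInfinityAlgebra

variable (g : LInfinityAlgebra.{u})

/-- The values on generators of the derivation that counts unshifted generators. -/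
noncomputable def eulerGen :
    ∀ i : ℕ+ × Bool, Module.Dual ℝ (g.space i.1) →ₗ[ℝ] g.weilAlg
  | (n, false) => g.unshifted n
  | (_, true) => 0

/-- The derivation of degree `0` that multiplies a monomial by the number of its unshifted
generators. -/
noncomputable def euler : g.weilAlg →ₗ[ℝ] g.weilAlg :=
  FreeGC.deriv 0 g.eulerGen (by
    rintro ⟨n, b⟩ i' a a'
    cases b with
    | false =>
      exact FreeGC.gen_comm weilDeg
        (fun i : ℕ+ × Bool => Module.Dual ℝ (g.space i.1)) (n, false) i' a a'
    | true => simp [eulerGen])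

theorem euler_gen_mul (i : ℕ+ × Bool) (a : Module.Dual ℝ (g.space i.1)) (x : g.weilAlg) :
    g.euler (g.weilGen i a * x) = g.eulerGen i a * x + g.weilGen i a * g.euler x := by
  rw [euler, FreeGC.deriv_gen_mul]
  simp

/-- The projection of the Weil algebra onto the subalgebra generated by the shifted generators, on
generators. -/
noncomputable def horizontalGen :
    ∀ i : ℕ+ × Bool, Module.Dual ℝ (g.space i.1) →ₗ[ℝ] g.weilAlg
  | (_, false) => 0
  | (n, true) => g.shifted n

/-- The projection of the Weil algebra onto the subalgebra generated by the shifted generators: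
`a ↦ 0` and `σ a ↦ σ a`. -/
noncomputable def horizontal : g.weilAlg →ₐ[ℝ] g.weilAlg :=
  FreeGC.lift g.horizontalGen (by
    rintro ⟨n, b⟩ ⟨m, c⟩ a a'
    cases b <;> cases c
    case true.true =>
      exact FreeGC.gen_comm weilDeg
        (fun i : ℕ+ × Bool => Module.Dual ℝ (g.space i.1)) (n, true) (m, true) a a'
    all_goals simp [horizontalGen])

theorem horizontal_gen (i : ℕ+ × Bool) (a : Module.Dual ℝ (g.space i.1)) :
    g.horizontal (g.weilGen i a) = g.horizontalGen i a :=
  FreeGC.lift_gen (deg := weilDeg) (V := fun i : ℕ+ × Bool => Module.Dual ℝ (g.space i.1)) _ _ i a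

/-- The image of `horizontal` is generated by shifted generators, which `euler` kills. -/
theorem euler_horizontal (x : g.weilAlg) : g.euler (g.horizontal x) = 0 := by
  refine FreeGC.induction_left (p := fun x => g.euler (g.horizontal x) = 0) ?_ ?_ ?_ ?_ x
  · simp [euler, FreeGC.deriv_one]
  · intro x y hx hy; simp only [map_add, hx, hy, add_zero]
  · intro c x hx; simp only [map_smul, hx, smul_zero]
  · rintro ⟨n, b⟩ a x hx
    rw [map_mul, g.horizontal_gen]
    cases b with
    | false => simp [horizontalGen]
    | true =>
      refine (g.euler_gen_mul (n, true) a _).trans ?_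
      rw [hx]; simp [eulerGen]

/-- Under a derivation of degree `0`, eigenvalues add in products. -/
theorem gen_mul_mem_eigenspace {i : ℕ+ × Bool} {a : Module.Dual ℝ (g.space i.1)} {c μ : ℝ}
    (hi : g.eulerGen i a = c • g.weilGen i a) {x : g.weilAlg}
    (hx : x ∈ Module.End.eigenspace g.euler μ) :
    g.weilGen i a * x ∈ Module.End.eigenspace g.euler (c + μ) := by
  rw [Module.End.mem_eigenspace_iff] at hx ⊢
  rw [euler_gen_mul, hi, hx, smul_mul_assoc, mul_smul_comm, add_smul]

theorem gen_mul_mem_iSup_eigenspace {i : ℕ+ × Bool} {a : Module.Dual ℝ (g.space i.1)} {c : ℝ}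
    (hc : 0 ≤ c) (hi : g.eulerGen i a = c • g.weilGen i a) {x : g.weilAlg}
    (hx : x ∈ ⨆ μ : {μ : ℝ // 0 < μ}, Module.End.eigenspace g.euler μ) :
    g.weilGen i a * x ∈ ⨆ μ : {μ : ℝ // 0 < μ}, Module.End.eigenspace g.euler μ := by
  induction hx using Submodule.iSup_induction' with
  | mem μ x hx =>
    exact Submodule.mem_iSup_of_mem (⟨c + μ, add_pos_of_nonneg_of_pos hc μ.2⟩ : {μ : ℝ // 0 < μ})
      (g.gen_mul_mem_eigenspace hi hx)
  | zero => rw [mul_zero]; exact Submodule.zero_mem _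
  | add x y _ _ hx hy => rw [mul_add]; exact Submodule.add_mem _ hx hy

/-- Subtracting `horizontal x` discards the monomials without unshifted generators; each remaining
monomial has a positive number of them, which is its eigenvalue. -/
theorem sub_horizontal_mem (x : g.weilAlg) :
    x - g.horizontal x ∈ ⨆ μ : {μ : ℝ // 0 < μ}, Module.End.eigenspace g.euler μ := by
  refine FreeGC.induction_left (p := fun x =>
    x - g.horizontal x ∈ ⨆ μ : {μ : ℝ // 0 < μ}, Module.End.eigenspace g.euler μ) ?_ ?_ ?_ ?_ x
  · rw [map_one, sub_self]; exact Submodule.zero_mem _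
  · intro x y hx hy
    rw [map_add, add_sub_add_comm]; exact Submodule.add_mem _ hx hy
  · intro c x hx
    rw [map_smul, ← smul_sub]; exact Submodule.smul_mem _ _ hx
  · rintro ⟨n, b⟩ a x hx
    rw [map_mul, g.horizontal_gen]
    cases b with
    | false =>
      have h1 : g.eulerGen (n, false) a = (1 : ℝ) • g.weilGen (n, false) a := (one_smul ℝ _).symm
      -- Here `horizontal (a x) = 0`, so `a x` itself must have positive weight. Split it as `a (x -
      -- horizontal x) + a (horizontal x)`: the second summand has weight `1 + 0`.
      have h2 := g.gen_mul_mem_eigenspace (μ := 0) h1 (x := g.horizontal x)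
        (by rw [Module.End.mem_eigenspace_iff, euler_horizontal, zero_smul])
      have h3 := Submodule.add_mem _ (g.gen_mul_mem_iSup_eigenspace zero_le_one h1 hx)
        (Submodule.mem_iSup_of_mem (p := fun μ : {μ : ℝ // 0 < μ} => Module.End.eigenspace g.euler μ)
          ⟨1 + 0, by norm_num⟩ h2)
      rw [← mul_add, sub_add_cancel] at h3
      simpa [horizontalGen] using h3
    | true =>
      have h1 : g.eulerGen (n, true) a = (0 : ℝ) • g.weilGen (n, true) a := (zero_smul ℝ _).symm
      have h2 := g.gen_mul_mem_iSup_eigenspace le_rfl h1 hx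
      rwa [mul_sub] at h2

/-- The difference `x - horizontal x` lies both in the eigenspace for `0` and in the sum of those
for positive eigenvalues; eigenspaces are independent, so it vanishes. -/
theorem horizontal_eq_self_of_euler_eq_zero {x : g.weilAlg} (hx : g.euler x = 0) :
    g.horizontal x = x := by
  have h0 : x - g.horizontal x ∈ Module.End.eigenspace g.euler 0 := by
    rw [Module.End.mem_eigenspace_iff, map_sub, hx, euler_horizontal, sub_zero, zero_smul]
  have h1 : (⨆ μ : {μ : ℝ // 0 < μ}, Module.End.eigenspace g.euler μ)
      ≤ ⨆ (μ : ℝ) (_ : μ ≠ 0), Module.End.eigenspace g.euler μ :=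
    iSup_le fun μ => le_iSup₂_of_le (μ : ℝ) μ.2.ne' le_rfl
  have h2 := (Module.End.eigenspaces_iSupIndep g.euler 0).le_bot
    ⟨h0, h1 (g.sub_horizontal_mem x)⟩
  exact (sub_eq_zero.1 ((Submodule.mem_bot ℝ).1 h2)).symm

/-! ### The counting derivation in terms of contractions. -/

instance finiteDimensional_space (n : ℕ+) : FiniteDimensional ℝ (g.space n) :=
  have := g.finite
  FiniteDimensional.of_injective (DirectSum.lof ℝ ℕ+ g.space n) (DirectSum.of_injective n)

theorem contraction_gen_mul (n : ℕ+) (X : g.space n) (i : ℕ+ × Bool)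
    (a : Module.Dual ℝ (g.space i.1)) (x : g.weilAlg) :
    g.contraction n X (g.weilGen i a * x) = g.contractionGen n X i a * x
      + (-1 : ℝ) ^ ((n : ℕ) * weilDeg i) • (g.weilGen i a * g.contraction n X x) :=
  FreeGC.deriv_gen_mul (n : ℕ) (g.contractionGen n X) _ i a x

/-- In degree `n` this is the expansion `a = ∑ a(e_j) eʲ` in the dual basis; contractions with `g_n`
kill all other generators. -/
theorem sum_unshifted_mul_contractionGen (n : ℕ+) (i : ℕ+ × Bool)
    (a : Module.Dual ℝ (g.space i.1)) :
    ∑ j, g.unshifted n ((Module.finBasis ℝ (g.space n)).coord j)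
        * g.contractionGen n (Module.finBasis ℝ (g.space n) j) i a
      = if n = i.1 then g.eulerGen i a else 0 := by
  obtain ⟨m, b⟩ := i
  cases b with
  | true => simp [contractionGen, eulerGen]
  | false =>
    split_ifs with h
    · dsimp only at h
      subst h
      have h1 := congrArg (g.unshifted n) ((Module.finBasis ℝ (g.space n)).sum_dual_apply_smul_coord a)
      rw [map_sum] at h1
      refine Eq.trans (Finset.sum_congr rfl fun j _ => ?_) h1
      rw [map_smul]
      change _ * algebraMap ℝ g.weilAlg (a (Pi.single n _ n)) = _
      rw [Pi.single_eq_same, ← Algebra.commutes, ← Algebra.smul_def]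
    · refine Finset.sum_eq_zero fun j _ => ?_
      change _ * algebraMap ℝ g.weilAlg (a (Pi.single n _ m)) = _
      rw [Pi.single_eq_of_ne (fun h' => h h'.symm), map_zero, map_zero, mul_zero]

/-- The operator `∑ aʲ ι_j` is a derivation of degree `0`: the sign from moving `ι_j` past a
generator cancels the one from moving `aʲ` past it. -/
theorem sum_unshifted_mul_contraction_gen_mul (n : ℕ+) (i : ℕ+ × Bool)
    (a : Module.Dual ℝ (g.space i.1)) (x : g.weilAlg) :
    ∑ j, g.unshifted n ((Module.finBasis ℝ (g.space n)).coord j)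
        * g.contraction n (Module.finBasis ℝ (g.space n) j) (g.weilGen i a * x)
      = (if n = i.1 then g.eulerGen i a else 0) * x + g.weilGen i a *
        ∑ j, g.unshifted n ((Module.finBasis ℝ (g.space n)).coord j)
          * g.contraction n (Module.finBasis ℝ (g.space n) j) x := by
  rw [← g.sum_unshifted_mul_contractionGen n i a, Finset.sum_mul, Finset.mul_sum,
    ← Finset.sum_add_distrib]
  refine Finset.sum_congr rfl fun j _ => ?_
  have h : g.unshifted n ((Module.finBasis ℝ (g.space n)).coord j) * g.weilGen i a
      = (-1 : ℝ) ^ ((n : ℕ) * weilDeg i) •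
        (g.weilGen i a * g.unshifted n ((Module.finBasis ℝ (g.space n)).coord j)) :=
    FreeGC.homog_mul_gen (g.unshifted_mem n _) i a
  rw [g.contraction_gen_mul, mul_add, mul_smul_comm, ← mul_assoc, ← mul_assoc, h, smul_mul_assoc,
    smul_smul, ← pow_add, Even.neg_one_pow (Even.add_self _), one_smul, mul_assoc (g.weilGen i a)]

/-- The counting derivation is the sum of all `aʲ ι_j`, for dual bases. -/
theorem exists_euler_eq_sum (x : g.weilAlg) : ∃ N : Finset ℕ+, ∀ N' : Finset ℕ+, N ⊆ N' →
    g.euler x = ∑ n ∈ N', ∑ j, g.unshifted n ((Module.finBasis ℝ (g.space n)).coord j)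
      * g.contraction n (Module.finBasis ℝ (g.space n) j) x := by
  -- `N` contains the degrees of the unshifted generators that occur in `x`; further degrees
  -- contribute zero. Allowing every larger `N'` lets sums of elements use a union.
  refine FreeGC.induction_left (p := fun x => ∃ N : Finset ℕ+, ∀ N' : Finset ℕ+, N ⊆ N' →
    g.euler x = ∑ n ∈ N', ∑ j, g.unshifted n ((Module.finBasis ℝ (g.space n)).coord j)
      * g.contraction n (Module.finBasis ℝ (g.space n) j) x) ?_ ?_ ?_ ?_ x
  · exact ⟨∅, fun N' _ => by simp [euler, contraction, FreeGC.deriv_one]⟩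
  · rintro x y ⟨N, hN⟩ ⟨N₁, hN₁⟩
    refine ⟨N ∪ N₁, fun N' h => ?_⟩
    rw [map_add, hN N' (Finset.union_subset_left h), hN₁ N' (Finset.union_subset_right h)]
    simp only [map_add, mul_add, Finset.sum_add_distrib]
  · rintro c x ⟨N, hN⟩
    refine ⟨N, fun N' h => ?_⟩
    rw [map_smul, hN N' h]
    simp only [map_smul, mul_smul_comm, Finset.smul_sum]
  · rintro i a x ⟨N, hN⟩
    refine ⟨insert i.1 N, fun N' h => ?_⟩
    obtain ⟨hi, h⟩ := Finset.insert_subset_iff.1 h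
    refine (g.euler_gen_mul i a x).trans ?_
    refine Eq.trans ?_ (Finset.sum_congr rfl fun n _ =>
      (g.sum_unshifted_mul_contraction_gen_mul n i a x).symm)
    rw [Finset.sum_add_distrib, ← Finset.sum_mul, ← Finset.mul_sum, ← hN N' h,
      Finset.sum_ite_eq' N' i.1, if_pos hi]

/-- An element of the Weil algebra that is annihilated by all contractions is a polynomial in the
shifted generators. -/
theorem horizontal_eq_self {x : g.weilAlg} (hx : ∀ (n : ℕ+) (X : g.space n), g.contraction n X x = 0) :
    g.horizontal x = x := by
  obtain ⟨N, hN⟩ := g.exists_euler_eq_sum x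
  refine g.horizontal_eq_self_of_euler_eq_zero ?_
  rw [hN N subset_rfl]
  simp [hx]

end LInfinityAlgebra

/-- Evaluation at fixed vectors is continuous and linear, so it commutes with the integral. This
reduces naturality of the fibre integral to a pointwise check. -/
theorem Alt.fibreIntegral_apply {m k : ℕ} {β : Cart (m + 1) → Alt (m + 1) (k + 1)}
    (hβ : ContDiff ℝ ∞ β) (x : Cart m) (v : Fin k → Cart m) :
    Alt.fibreIntegral β x v = ∫ t in (0 : ℝ)..1, β ((Cart.split m).symm (x, t))
      (Matrix.vecCons (Cart.dt m) fun i => Cart.inl m (v i)) := by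
  have hc : IntervalIntegrable (fun t : ℝ => Alt.contractTime m k (β ((Cart.split m).symm (x, t))))
      MeasureTheory.volume 0 1 := by
    refine Continuous.intervalIntegrable ?_ 0 1
    exact (Alt.contDiff_contractTime hβ).continuous.comp (by fun_prop)
  exact ((Alt.evalAt v).intervalIntegral_comp_comm hc).symm

/-! ### Forms on `M × [0,1]` -/

section Cylinder

variable {E : Type*} [NormedAddCommGroup E] [NormedSpace ℝ E] {H : Type*}
    [TopologicalSpace H] {I : ModelWithCorners ℝ E H} {M : Type u} [TopologicalSpace M]
    [ChartedSpace H M]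

/-- A smooth map `ℝ → [0,1]` that sends `0` to `0` and `1` to `1`. -/
noncomputable def smoothStep : C^∞⟮𝓘(ℝ, ℝ), ℝ; 𝓡∂ 1, Set.Icc (0 : ℝ) 1⟯ :=
  -- `Real.smoothTransition` already takes values in `[0,1]`, so the projection only restricts the
  -- codomain.
  ⟨fun t => Set.projIcc 0 1 zero_le_one (Real.smoothTransition t),
    (contMDiffOn_projIcc (x := (0 : ℝ)) (y := 1)).comp_contMDiff
      Real.smoothTransition.contDiff.contMDiff
      fun t => ⟨Real.smoothTransition.nonneg t, Real.smoothTransition.le_one t⟩⟩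

theorem smoothStep_zero : smoothStep 0 = 0 := by
  change Set.projIcc (0 : ℝ) 1 zero_le_one (Real.smoothTransition 0) = 0
  rw [Real.smoothTransition.zero]
  exact Set.projIcc_left zero_le_one

theorem smoothStep_one : smoothStep 1 = 1 := by
  change Set.projIcc (0 : ℝ) 1 zero_le_one (Real.smoothTransition 1) = 1
  rw [Real.smoothTransition.one]
  exact Set.projIcc_right zero_le_one

/-- The inclusion `ℝ^m → ℝ^(m+1)` at height `t`. -/
noncomputable def Cart.insertTime (m : ℕ) (t : ℝ) :
    C^∞⟮𝓘(ℝ, Cart m), Cart m; 𝓘(ℝ, Cart (m + 1)), Cart (m + 1)⟯ :=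
  ⟨fun x => (Cart.split m).symm (x, t),
    ((Cart.split m).symm.contDiff.comp (contDiff_id.prodMk contDiff_const)).contMDiff⟩

/-- The map `f × id : ℝ^m' × ℝ → ℝ^m × ℝ`. -/
noncomputable def Cart.timesLine {m m' : ℕ}
    (f : C^∞⟮𝓘(ℝ, Cart m'), Cart m'; 𝓘(ℝ, Cart m), Cart m⟯) :
    C^∞⟮𝓘(ℝ, Cart (m' + 1)), Cart (m' + 1); 𝓘(ℝ, Cart (m + 1)), Cart (m + 1)⟯ :=
  ⟨fun y => (Cart.split m).symm (f (Cart.split m' y).1, (Cart.split m' y).2), by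
    have hf : ContDiff ℝ ∞ f := f.contMDiff.contDiff
    exact ((Cart.split m).symm.contDiff.comp
      ((hf.comp (contDiff_fst.comp (Cart.split m').contDiff)).prodMk
        (contDiff_snd.comp (Cart.split m').contDiff))).contMDiff⟩

/-- The differential of `f × id` is `df × id`: it preserves `dt` and sends `inl v` to `inl (df v)`,
as naturality of the fibre integral requires. -/
theorem Cart.fderiv_timesLine {m m' : ℕ}
    (f : C^∞⟮𝓘(ℝ, Cart m'), Cart m'; 𝓘(ℝ, Cart m), Cart m⟯) (x : Cart m') (t : ℝ)
    (u : Cart m' × ℝ) :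
    fderiv ℝ (Cart.timesLine f) ((Cart.split m').symm (x, t)) ((Cart.split m').symm u)
      = (Cart.split m).symm (fderiv ℝ f x u.1, u.2) := by
  have hf : ContDiff ℝ ∞ f := f.contMDiff.contDiff
  set y := (Cart.split m').symm (x, t) with hy
  have hx : (Cart.split m' y).1 = x := by simp [hy]
  have h1 := (Cart.split m').hasFDerivAt (x := y)
  have h2 : HasFDerivAt f (fderiv ℝ f x) (Cart.split m' y).1 := by
    rw [hx]; exact (hf.differentiable (by simp) x).hasFDerivAt
  have h3 := (Cart.split m).symm.hasFDerivAt.comp y ((h2.comp y h1.fst).prodMk h1.snd)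
  have h4 : fderiv ℝ (Cart.timesLine f) y = _ := h3.fderiv
  rw [h4]
  simp

/-- The product of a plot of `M` with the smooth map `ℝ → [0,1]`. -/
noncomputable def Plot.cylinder {m : ℕ} (p : Plot I M m) :
    Plot (I.prod (𝓡∂ 1)) (M × Set.Icc (0 : ℝ) 1) (m + 1) :=
  ⟨fun y => (p (Cart.split m y).1, smoothStep (Cart.split m y).2),
    (p.contMDiff.comp (contDiff_fst.comp (Cart.split m).contDiff).contMDiff).prodMk
      (smoothStep.contMDiff.comp (contDiff_snd.comp (Cart.split m).contDiff).contMDiff)⟩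

theorem Plot.cylinder_comp_insertTime {m : ℕ} (p : Plot I M m) (t : ℝ) :
    p.cylinder.comp (Cart.insertTime m t) = (atTime I M (smoothStep t)).comp p := by
  refine ContMDiffMap.ext fun x => ?_
  change (p (Cart.split m ((Cart.split m).symm (x, t))).1,
    smoothStep (Cart.split m ((Cart.split m).symm (x, t))).2) = (p x, smoothStep t)
  simp

theorem Plot.cylinder_comp_timesLine {m m' : ℕ} (p : Plot I M m)
    (f : C^∞⟮𝓘(ℝ, Cart m'), Cart m'; 𝓘(ℝ, Cart m), Cart m⟯) :
    p.cylinder.comp (Cart.timesLine f) = Plot.cylinder (p.comp f) := by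
  refine ContMDiffMap.ext fun y => ?_
  change (p (Cart.split m ((Cart.split m).symm (f (Cart.split m' y).1, (Cart.split m' y).2))).1,
    smoothStep (Cart.split m ((Cart.split m).symm (f (Cart.split m' y).1, (Cart.split m' y).2))).2)
      = (p (f (Cart.split m' y).1), smoothStep (Cart.split m' y).2)
  simp

namespace DiffForm

/-- The slice of the cylinder plot at height `t` is `p` placed at time `smoothStep t`, so
restrictions to a time can be read off on the cylinder. -/
theorem pullback_atTime_onPlot {k : ℕ} (α : DiffForm (I.prod (𝓡∂ 1)) (M × Set.Icc (0 : ℝ) 1) k)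
    (t : ℝ) {m : ℕ} (p : Plot I M m) (x : Cart m) :
    (pullback (atTime I M (smoothStep t)) k α).onPlot p x
      = (α.onPlot p.cylinder ((Cart.split m).symm (x, t))).compContinuousLinearMap (Cart.inl m) := by
  change α.onPlot ((atTime I M (smoothStep t)).comp p) x = _
  rw [← Plot.cylinder_comp_insertTime, α.natural]
  have h : fderiv ℝ (Cart.insertTime m t) x = Cart.inl m :=
    (Cart.hasFDerivAt_split_symm_mk m x t).fderiv
  rw [h]
  rfl

/-- Integration of forms on `M × [0,1]` along `[0,1]`. -/
noncomputable def fibreIntegral {k : ℕ}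
    (α : DiffForm (I.prod (𝓡∂ 1)) (M × Set.Icc (0 : ℝ) 1) (k + 1)) : DiffForm I M k :=
  ⟨fun _ p => Alt.fibreIntegral (α.onPlot p.cylinder),
    fun _ p => Alt.contDiff_fibreIntegral (α.contDiff _ _),
    fun m m' p f x => by
      ext v
      rw [Alt.fibreIntegral_apply (α.contDiff _ _)]
      refine Eq.trans ?_ (Alt.fibreIntegral_apply (α.contDiff _ _) (f x) _).symm
      refine intervalIntegral.integral_congr fun t _ => ?_
      dsimp only
      rw [← Plot.cylinder_comp_timesLine, α.natural]
      have h : Cart.timesLine f ((Cart.split m').symm (x, t)) = (Cart.split m).symm (f x, t) := by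
        change (Cart.split m).symm (f (Cart.split m' ((Cart.split m').symm (x, t))).1,
          (Cart.split m' ((Cart.split m').symm (x, t))).2) = _
        simp
      rw [h]
      change α.onPlot p.cylinder _ _ = _
      -- Both integrands evaluate the same alternating form; it remains to match the arguments,
      -- first `dt` and then the vectors from `ℝ^m'`.
      congr 1
      funext i
      cases i using Fin.cases with
      | zero => exact (Cart.fderiv_timesLine f x t (0, 1)).trans (by simp [Cart.dt])
      | succ i => exact (Cart.fderiv_timesLine f x t (v i, 0)).trans (by simp; rfl)⟩

/-- The homotopy formula for closed forms on `M × [0,1]`. -/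
theorem d_fibreIntegral {k : ℕ} {α : DiffForm (I.prod (𝓡∂ 1)) (M × Set.Icc (0 : ℝ) 1) (k + 1)}
    (hα : d _ _ _ α = 0) :
    d I M k (fibreIntegral α)
      = pullback (atTime I M 1) (k + 1) α - pullback (atTime I M 0) (k + 1) α := by
  refine DiffForm.ext fun m p x => ?_
  refine (Alt.extDeriv_fibreIntegral (α.contDiff _ p.cylinder) (fun y => ?_) x).trans ?_
  · exact congrArg (fun γ : DiffForm _ _ _ => γ.onPlot p.cylinder y) hα
  · rw [← pullback_atTime_onPlot, ← pullback_atTime_onPlot, smoothStep_zero, smoothStep_one]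
    rfl

theorem pullback_atTime_eq_of_fderiv_dt {k : ℕ}
    {α : DiffForm (I.prod (𝓡∂ 1)) (M × Set.Icc (0 : ℝ) 1) k}
    (h : ∀ (m : ℕ) (p : Plot I M m) (y : Cart (m + 1)) (v : Fin k → Cart (m + 1)),
      fderiv ℝ (α.onPlot p.cylinder) y (Cart.dt m) v = 0) :
    pullback (atTime I M 0) k α = pullback (atTime I M 1) k α := by
  refine DiffForm.ext fun m p x => ?_
  rw [← smoothStep_zero, ← smoothStep_one, pullback_atTime_onPlot, pullback_atTime_onPlot]
  exact Alt.compContinuousLinearMap_inl_eq_of_fderiv_dt (α.contDiff _ _) x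
    (fun t v => h m p _ v) 0 1

theorem pullback_atTime_eq_of_d_eq_zero {α : DiffForm (I.prod (𝓡∂ 1)) (M × Set.Icc (0 : ℝ) 1) 0}
    (hα : d _ _ _ α = 0) : pullback (atTime I M 0) 0 α = pullback (atTime I M 1) 0 α := by
  refine pullback_atTime_eq_of_fderiv_dt fun m p y v => ?_
  rw [← extDeriv_vecCons_zero]
  exact congrArg (fun γ : DiffForm _ _ 1 => γ.onPlot p.cylinder y _) hα

end DiffForm

/-! ### Forms without `dt` component. -/

namespace NoIntervalPart

open DiffForm

/-- The `M`-component of a cylinder plot factors through the projection to `ℝ^m`, which kills `dt`.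
-/
theorem onPlot_cylinder {k : ℕ} {α : DiffForm (I.prod (𝓡∂ 1)) (M × Set.Icc (0 : ℝ) 1) k}
    (hα : NoIntervalPart α) {m : ℕ} (p : Plot I M m) (y : Cart (m + 1))
    (v : Fin k → Cart (m + 1)) (j : Fin k) (hj : v j = Cart.dt m) :
    α.onPlot p.cylinder y v = 0 := by
  refine hα _ p.cylinder y v j ?_
  let L : Cart (m + 1) →L[ℝ] Cart m := (ContinuousLinearMap.fst ℝ (Cart m) ℝ).comp
    (Cart.split m : Cart (m + 1) →L[ℝ] Cart m × ℝ)
  have h : mfderiv 𝓘(ℝ, Cart (m + 1)) I (p ∘ L) y = _ :=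
    mfderiv_comp y (p.contMDiff.mdifferentiable (by simp) (L y)) L.differentiableAt.mdifferentiableAt
  have h1 : L (Cart.dt m) = 0 := by simp [L, Cart.dt]
  change mfderiv 𝓘(ℝ, Cart (m + 1)) I (p ∘ L) y (v j) = 0
  rw [h, hj, mfderiv_eq_fderiv, L.fderiv]
  change mfderiv 𝓘(ℝ, Cart m) I p (L y) (L (Cart.dt m)) = 0
  rw [h1]
  exact map_zero _

/-- If neither `α` nor `dα` has a component along `dt`, then `α` does not depend on `t`. -/
theorem pullback_atTime_eq {k : ℕ} {α : DiffForm (I.prod (𝓡∂ 1)) (M × Set.Icc (0 : ℝ) 1) k}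
    (hα : NoIntervalPart α) (hd : NoIntervalPart (d _ _ _ α)) :
    pullback (atTime I M 0) k α = pullback (atTime I M 1) k α :=
  pullback_atTime_eq_of_fderiv_dt fun _ p y v =>
    Alt.fderiv_dt_eq_zero (α.contDiff _ _) (fun y v j hj => hα.onPlot_cylinder p y v j hj)
      (fun y _ => hd.onPlot_cylinder p y _ 0 rfl) y v

theorem wedge {k l : ℕ} {α : DiffForm (I.prod (𝓡∂ 1)) (M × Set.Icc (0 : ℝ) 1) k}
    {β : DiffForm (I.prod (𝓡∂ 1)) (M × Set.Icc (0 : ℝ) 1) l}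
    (hα : NoIntervalPart α) (hβ : NoIntervalPart β) :
    NoIntervalPart (DiffForm.wedge _ _ k l α β) := by
  intro m p x v j hj
  change LinearMap.mul' ℝ ℝ
    ((∑ σ : Equiv.Perm.ModSumCongr (Fin k) (Fin l), AlternatingMap.domCoprod.summand
      (α.onPlot p x).toAlternatingMap (β.onPlot p x).toAlternatingMap σ) (v ∘ finSumFinEquiv)) = 0
  simp only [sum_apply, map_sum]
  refine Finset.sum_eq_zero fun σ _ => ?_
  induction σ using Quotient.inductionOn' with | _ σ =>
  change LinearMap.mul' ℝ ℝ
    (Equiv.Perm.sign σ • TensorProduct.tmul ℝ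
      (α.onPlot p x fun i => v (finSumFinEquiv (σ (Sum.inl i))))
      (β.onPlot p x fun i => v (finSumFinEquiv (σ (Sum.inr i))))) = 0
  -- In each shuffle term the argument `v j` is fed to exactly one of the two factors, and that
  -- factor vanishes.
  obtain ⟨i, hi⟩ : ∃ i, finSumFinEquiv (σ i) = j :=
    ⟨σ.symm (finSumFinEquiv.symm j), by simp⟩
  cases i with
  | inl i =>
    rw [hα m p x _ i (by rw [hi]; exact hj), TensorProduct.zero_tmul, smul_zero, map_zero]
  | inr i =>
    rw [hβ m p x _ i (by rw [hi]; exact hj), TensorProduct.tmul_zero, smul_zero, map_zero]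

variable {g : LInfinityAlgebra.{v}}
    {η : DGHom g.W (deRham (I.prod (𝓡∂ 1)) (M × Set.Icc (0 : ℝ) 1))}

/-- `horizontal x` is a polynomial in shifted generators, whose images have no `dt` component, and
wedge products preserve this. Homogeneity is part of the claim because `η` is defined degree by
degree. -/
theorem toLin_horizontal
    (hη : ∀ (k : ℕ+) (a : Module.Dual ℝ (g.space k)),
      NoIntervalPart (η.toLin (k + 1) ⟨g.shifted k a, g.shifted_mem k a⟩))
    {k : ℕ} {x : g.weilAlg} (hx : x ∈ g.weilHomog k) :
    ∃ h : g.horizontal x ∈ g.weilHomog k, NoIntervalPart (η.toLin k ⟨g.horizontal x, h⟩) := by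
  have zero : ∀ k, NoIntervalPart (η.toLin k 0) := fun k => by
    rw [map_zero]; exact fun _ _ _ _ _ _ => rfl
  refine FreeGC.homog_induction (p := fun k x => ∃ h : g.horizontal x ∈ g.weilHomog k,
    NoIntervalPart (η.toLin k ⟨g.horizontal x, h⟩)) ?_ ?_ ?_ ?_ ?_ hx
  · intro k
    rw [map_zero]
    exact ⟨Submodule.zero_mem _, zero k⟩
  · rw [map_one]
    -- A form of degree `0` has no arguments, so the condition is vacuous.
    exact ⟨FreeGC.one_mem_homog, fun _ _ _ _ j => j.elim0⟩
  · rintro k x y ⟨hx, hx'⟩ ⟨hy, hy'⟩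
    rw [map_add]
    refine ⟨Submodule.add_mem _ hx hy, fun m p z v j hj => ?_⟩
    have h : η.toLin k ⟨g.horizontal x + g.horizontal y, Submodule.add_mem _ hx hy⟩
      = η.toLin k ⟨g.horizontal x, hx⟩ + η.toLin k ⟨g.horizontal y, hy⟩ :=
      map_add (η.toLin k) (⟨g.horizontal x, hx⟩ : g.weilHomog k) (⟨g.horizontal y, hy⟩ : g.weilHomog k)
    rw [h]
    change DiffForm.onPlot _ p z v + DiffForm.onPlot _ p z v = 0
    rw [hx' m p z v j hj, hy' m p z v j hj, add_zero]
  · rintro k c x ⟨hx, hx'⟩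
    rw [map_smul]
    refine ⟨Submodule.smul_mem _ c hx, fun m p z v j hj => ?_⟩
    have h : η.toLin k ⟨c • g.horizontal x, Submodule.smul_mem _ c hx⟩
      = c • η.toLin k ⟨g.horizontal x, hx⟩ :=
      map_smul (η.toLin k) c (⟨g.horizontal x, hx⟩ : g.weilHomog k)
    rw [h]
    change c * DiffForm.onPlot _ p z v = 0
    rw [hx' m p z v j hj, mul_zero]
  · rintro ⟨n, b⟩ a k x - ⟨hx, hx'⟩
    rw [map_mul, g.horizontal_gen]
    cases b with
    | false =>
      have h : g.horizontalGen (n, false) a * g.horizontal x = 0 := zero_mul _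
      rw [h]
      exact ⟨Submodule.zero_mem _, zero _⟩
    | true =>
      refine ⟨FreeGC.mul_mem_homog (g.shifted_mem n a) hx, ?_⟩
      have h := η.map_mul (n + 1) k ⟨g.shifted n a, g.shifted_mem n a⟩ ⟨g.horizontal x, hx⟩
      have h' := (hη n a).wedge hx'
      exact Eq.mpr (congrArg NoIntervalPart h) h'

theorem toLin_of_contraction_eq_zero
    (hη : ∀ (k : ℕ+) (a : Module.Dual ℝ (g.space k)),
      NoIntervalPart (η.toLin (k + 1) ⟨g.shifted k a, g.shifted_mem k a⟩))
    {k : ℕ} (x : g.W.obj k) (hx : ∀ (n : ℕ+) (X : g.space n), g.contraction n X x.1 = 0) :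
    NoIntervalPart (η.toLin k x) := by
  obtain ⟨x, hxk⟩ := x
  obtain ⟨h, h'⟩ := toLin_horizontal hη hxk
  have e : (⟨g.horizontal x, h⟩ : g.weilHomog k) = ⟨x, hxk⟩ := Subtype.ext (g.horizontal_eq_self hx)
  rwa [e] at h'

end NoIntervalPart

end Cylinder

/-! ### Pullback along a surjective submersion is injective -/

section Submersion

open OpenPartialHomeomorph

/-- Every point of `ℝ^m` has arbitrarily small neighbourhoods parametrised by `ℝ^m`. -/
theorem Cart.exists_contMDiffMap_range_subset {m : ℕ} {x : Cart m} {U : Set (Cart m)}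
    (hU : U ∈ nhds x) :
    ∃ f : C^∞⟮𝓘(ℝ, Cart m), Cart m; 𝓘(ℝ, Cart m), Cart m⟯,
      f 0 = x ∧ (∀ z, f z ∈ U) ∧ Function.Surjective (fderiv ℝ f 0) := by
  obtain ⟨r, hr, hrU⟩ := Metric.mem_nhds_iff.1 hU
  have hf : ContDiff ℝ ∞ (univBall x r) := contDiff_univBall
  have hx : x ∈ Metric.ball x r := Metric.mem_ball_self hr
  refine ⟨⟨univBall x r, hf.contMDiff⟩, univBall_apply_zero x r, fun z => hrU ?_, ?_⟩
  · rw [← univBall_target x hr]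
    exact (univBall x r).map_source (by simp)
  · have h1 : DifferentiableAt ℝ (univBall x r).symm x :=
      (contDiffOn_univBall_symm (n := ⊤)).differentiableOn (by simp) |>.differentiableAt
        (Metric.isOpen_ball.mem_nhds hx)
    have h2 : HasFDerivAt (univBall x r) (fderiv ℝ (univBall x r) 0) ((univBall x r).symm x) := by
      rw [univBall_symm_apply_center]
      exact (hf.differentiable (by simp) 0).hasFDerivAt
    -- Differentiating this identity at `x` gives a right inverse of the differential at `0`.
    have h3 : univBall x r ∘ (univBall x r).symm =ᶠ[nhds x] id := by
      filter_upwards [Metric.isOpen_ball.mem_nhds hx] with y hy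
      exact (univBall x r).right_inv (by rwa [univBall_target x hr])
    have h4 := (h2.comp x h1.hasFDerivAt).unique ((hasFDerivAt_id x).congr_of_eventuallyEq h3)
    exact fun u => ⟨_, congrArg (fun L : Cart m →L[ℝ] Cart m => L u) h4⟩

variable {n : ℕ} {X : Type v} [TopologicalSpace X] [ChartedSpace (EuclideanSpace ℝ (Fin n)) X]
  {m : ℕ} {Y : Type w} [TopologicalSpace Y] [ChartedSpace (EuclideanSpace ℝ (Fin m)) Y]

/-- Plots lift locally along a surjective submersion. -/
theorem Plot.exists_local_lift {π : C^∞⟮𝓡 m, Y; 𝓡 n, X⟯} (hπ : Function.Surjective π)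
    (hπs : Manifold.IsSubmersion (𝓡 m) (𝓡 n) ∞ π) {l : ℕ} (p : Plot (𝓡 n) X l) (x : Cart l) :
    ∃ (f : C^∞⟮𝓘(ℝ, Cart l), Cart l; 𝓘(ℝ, Cart l), Cart l⟯) (q : Plot (𝓡 m) Y l),
      f 0 = x ∧ Function.Surjective (fderiv ℝ f 0) ∧ π.comp q = p.comp f := by
  obtain ⟨y, hy⟩ := hπ (p x)
  obtain ⟨F, _, _, h⟩ := hπs.isSubmersionAt y
  set φ := h.domChart.extend (𝓡 m) with hφ
  set ψ := h.codChart.extend (𝓡 n) with hψ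
  -- In the charts `φ`, `ψ` the submersion is the projection to the first factor. The lift keeps the
  -- second coordinate constant, equal to that of the chosen preimage `y`.
  set c := (h.equiv (φ y)).2
  have hyφ : y ∈ φ.source := by simpa [hφ] using h.mem_domChart_source
  have hyψ : p x ∈ h.codChart.source := hy ▸ h.mem_codChart_source
  have hyt : φ y ∈ φ.target := φ.map_source hyφ
  have hψy : ψ (p x) = (h.equiv (φ y)).1 := by
    have := h.writtenInCharts hyt
    simp only [Function.comp_apply] at this
    rw [← this, ← hφ, φ.left_inv hyφ, hy]
  let s : Cart l → EuclideanSpace ℝ (Fin m) := fun z => h.equiv.symm (ψ (p z), c)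
  have hsx : s x = φ y := by
    change h.equiv.symm (ψ (p x), c) = _
    rw [hψy]; exact h.equiv.symm_apply_apply _
  have hU₁ : IsOpen (p ⁻¹' h.codChart.source) :=
    h.codChart.open_source.preimage p.contMDiff.continuous
  have hs : ContMDiffOn 𝓘(ℝ, Cart l) 𝓘(ℝ, EuclideanSpace ℝ (Fin m)) ∞ s
      (p ⁻¹' h.codChart.source) := by
    have h1 : ContMDiffOn 𝓘(ℝ, Cart l) 𝓘(ℝ, EuclideanSpace ℝ (Fin n)) ∞ (fun z => ψ (p z))
        (p ⁻¹' h.codChart.source) :=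
      (contMDiffOn_extend h.codChart_mem_maximalAtlas).comp p.contMDiff.contMDiffOn
        (fun _ hz => hz)
    exact (h.equiv.symm.contDiff.comp_contDiffOn (h1.contDiffOn.prodMk contDiffOn_const)).contMDiffOn
  have hφt : IsOpen φ.target := h.domChart.isOpen_extend_target
  -- The lift `φ.symm ∘ s` makes sense only on this neighbourhood. Plots are defined on all of
  -- `ℝ^l`, whence the reparametrisation `f` with values in it.
  have hU : p ⁻¹' h.codChart.source ∩ s ⁻¹' φ.target ∈ nhds x :=
    (hs.continuousOn.isOpen_inter_preimage hU₁ hφt).mem_nhds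
      ⟨hyψ, by rw [Set.mem_preimage, hsx]; exact hyt⟩
  obtain ⟨f, hfx, hfU, hf⟩ := Cart.exists_contMDiffMap_range_subset hU
  have hq : ContMDiff 𝓘(ℝ, Cart l) (𝓡 m) ∞ fun z => φ.symm (s (f z)) := by
    have h1 := contMDiffOn_extend_symm h.domChart_mem_maximalAtlas
    have h2 : (𝓡 m) '' h.domChart.target = φ.target := by simp [hφ]
    rw [h2] at h1
    exact h1.comp_contMDiff (hs.comp_contMDiff f.contMDiff fun z => (hfU z).1) fun z => (hfU z).2
  refine ⟨f, ⟨_, hq⟩, hfx, hf, ContMDiffMap.ext fun z => ?_⟩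
  change π (φ.symm (s (f z))) = p (f z)
  have h1 : ψ (π (φ.symm (s (f z)))) = (h.equiv (s (f z))).1 := h.writtenInCharts (hfU z).2
  have h2 : (h.equiv (s (f z))).1 = ψ (p (f z)) :=
    congrArg Prod.fst (h.equiv.apply_symm_apply (ψ (p (f z)), c))
  have h3 : φ.symm (s (f z)) ∈ h.domChart.source := by
    simpa [hφ] using φ.map_target (hfU z).2
  refine ψ.injOn ?_ ?_ (h1.trans h2)
  · rw [hψ, extend_source]; exact h.source_subset_preimage_source h3
  · rw [hψ, extend_source]; exact (hfU z).1

/-- After a reparametrisation `f` with `f 0 = x` and surjective differential at `0`, every plot of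
`X` lifts to `Y`. If `π^*α = 0`, then `α` on the plot vanishes at `x` on all vectors `df(w)`, that
is, on all vectors. -/
theorem DiffForm.pullback_injective {π : C^∞⟮𝓡 m, Y; 𝓡 n, X⟯} (hπ : Function.Surjective π)
    (hπs : Manifold.IsSubmersion (𝓡 m) (𝓡 n) ∞ π) (k : ℕ) :
    Function.Injective (DiffForm.pullback π k) := by
  refine (injective_iff_map_eq_zero _).2 fun α hα => DiffForm.ext fun l p x => ?_
  obtain ⟨f, q, hfx, hf, hq⟩ := p.exists_local_lift hπ hπs x
  have h0 : α.onPlot (π.comp q) 0 = 0 :=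
    congrArg (fun γ : DiffForm (𝓡 m) Y k => γ.onPlot q 0) hα
  rw [hq, α.natural, hfx] at h0
  change α.onPlot p x = 0
  ext v
  choose w hw using fun i => hf (v i)
  have h1 : α.onPlot p x (fun i => fderiv ℝ f 0 (w i)) = 0 :=
    congrArg (fun a : Alt l k => a w) h0
  rwa [funext hw] at h1

end Submersion

/-! ### Concordances and gauge transformations -/

namespace Concordance

variable {g : LInfinityAlgebra.{u}}
  {n : ℕ} {X : Type v} [TopologicalSpace X] [ChartedSpace (EuclideanSpace ℝ (Fin n)) X]
  {m : ℕ} {Y : Type w} [TopologicalSpace Y] [ChartedSpace (EuclideanSpace ℝ (Fin m)) Y]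
  {π : C^∞⟮𝓡 m, Y; 𝓡 n, X⟯} {D D' : ConnectionDescent g π}

theorem pullback_zero_κ (c : Concordance D D') (k : ℕ) (P : g.inv.obj k) :
    DiffForm.pullback (atTime (𝓡 n) X 0) k (c.κ.toLin k P) = D.K.toLin k P :=
  congrArg (fun f : DGHom g.inv (deRham (𝓡 n) X) => f.toLin k P) c.source_base

theorem pullback_one_κ (c : Concordance D D') (k : ℕ) (P : g.inv.obj k) :
    DiffForm.pullback (atTime (𝓡 n) X 1) k (c.κ.toLin k P) = D'.K.toLin k P :=
  congrArg (fun f : DGHom g.inv (deRham (𝓡 n) X) => f.toLin k P) c.target_base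

theorem sub_mem_coboundaries (c : Concordance D D') (k : ℕ) (P : g.inv.obj k) (hP : P ∈ g.inv.cocycles k) :
    D.K.toLin k P - D'.K.toLin k P ∈ (deRham (𝓡 n) X).coboundaries k := by
  have hd : DiffForm.d _ _ _ (c.κ.toLin k P) = 0 := c.κ.mem_cocycles k P hP
  rw [← c.pullback_zero_κ, ← c.pullback_one_κ]
  cases k with
  | zero => exact sub_eq_zero.2 (DiffForm.pullback_atTime_eq_of_d_eq_zero hd)
  | succ k =>
    -- The homotopy formula gives time `1` minus time `0`, the opposite of the required difference.
    exact (Submodule.neg_mem_iff _).1 ⟨DiffForm.fibreIntegral (c.κ.toLin (k + 1) P),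
      (DiffForm.d_fibreIntegral hd).trans (neg_sub _ _).symm⟩

theorem charClasses_eq (c : Concordance D D') (k : ℕ) : D.charClasses k = D'.charClasses k := by
  refine LinearMap.ext fun x => ?_
  induction x using Submodule.Quotient.induction_on with | _ P =>
  exact (Submodule.Quotient.eq _).2 (c.sub_mem_coboundaries k P.1 P.2)

/-- The comparison is made on `Y`, where verticality controls `η`, and descends to `X` because `π^*`
is injective. -/
theorem IsVertical.charForms_eq {c : Concordance D D'} (hc : c.IsVertical) (hπ : Function.Surjective π)
    (hπs : Manifold.IsSubmersion (𝓡 m) (𝓡 n) ∞ π) (k : ℕ) : D.charForms k = D'.charForms k := by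
  refine LinearMap.ext fun P => DiffForm.pullback_injective hπ hπs k ?_
  have hP := (g.mem_invHomog.1 P.2).2
  have h := NoIntervalPart.toLin_of_contraction_eq_zero hc (g.invToW.toLin k P)
    fun n X => (hP n X).1
  -- The second defining condition `ι_X d_W P = 0` of an invariant polynomial enters here: it
  -- removes the `dt` component of `η(d_W P) = dη(P)`.
  have hd := NoIntervalPart.toLin_of_contraction_eq_zero hc (g.W.d k (g.invToW.toLin k P))
    fun n X => (hP n X).2
  rw [c.η.map_d] at hd
  have h0 : DiffForm.pullback (atTime (𝓡 m) Y 0) k (c.η.toLin k (g.invToW.toLin k P))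
      = D.A.toLin k (g.invToW.toLin k P) :=
    congrArg (fun f : DGHom g.W (deRham (𝓡 m) Y) => f.toLin k (g.invToW.toLin k P)) c.source
  have h1 : DiffForm.pullback (atTime (𝓡 m) Y 1) k (c.η.toLin k (g.invToW.toLin k P))
      = D'.A.toLin k (g.invToW.toLin k P) :=
    congrArg (fun f : DGHom g.W (deRham (𝓡 m) Y) => f.toLin k (g.invToW.toLin k P)) c.target
  have hb : DiffForm.pullback π k (D.K.toLin k P) = D.A.toLin k (g.invToW.toLin k P) :=
    congrArg (fun f : DGHom g.inv (deRham (𝓡 m) Y) => f.toLin k P) D.bottom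
  have hb' : DiffForm.pullback π k (D'.K.toLin k P) = D'.A.toLin k (g.invToW.toLin k P) :=
    congrArg (fun f : DGHom g.inv (deRham (𝓡 m) Y) => f.toLin k P) D'.bottom
  exact hb.trans (h0.symm.trans ((h.pullback_atTime_eq hd).trans (h1.trans hb'.symm)))

end Concordance

theorem mainTheorem1 (g : LInfinityAlgebra)
    {n : ℕ} {X : Type*} [TopologicalSpace X] [ChartedSpace (EuclideanSpace ℝ (Fin n)) X]
    [IsManifold (𝓡 n) ∞ X]
    {m : ℕ} {Y : Type*} [TopologicalSpace Y] [ChartedSpace (EuclideanSpace ℝ (Fin m)) Y]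
    [IsManifold (𝓡 m) ∞ Y]
    {m' : ℕ} {Y' : Type*} [TopologicalSpace Y'] [ChartedSpace (EuclideanSpace ℝ (Fin m')) Y']
    [IsManifold (𝓡 m') ∞ Y']
    (π : C^∞⟮𝓡 m, Y; 𝓡 n, X⟯) (hπ : Function.Surjective π)
    (hπs : Manifold.IsSubmersion (𝓡 m) (𝓡 n) ∞ π)
    (π' : C^∞⟮𝓡 m', Y'; 𝓡 n, X⟯) (hπ' : Function.Surjective π')
    (hπs' : Manifold.IsSubmersion (𝓡 m') (𝓡 n) ∞ π')
    (D : ConnectionDescent g π) (D' : ConnectionDescent g π') :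
    (Concordant.{t} D D' → ∀ k : ℕ, D.charClasses k = D'.charClasses k) ∧
      (GaugeEquivalent.{t} D D' → ∀ k : ℕ, D.charForms k = D'.charForms k) := by
  refine ⟨?_, ?_⟩
  · rintro ⟨R, ⟨c⟩⟩ k
    -- Pullback to the refinement leaves `K` as it is, so the classes of the pulled-back objects are
    -- those of `D` and `D'` by definition; likewise for the forms.
    exact c.charClasses_eq k
  · rintro ⟨R, c, hc⟩ k
    exact hc.charForms_eq R.surjective R.submersion k
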